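/- Consider an asynchronous message-passing system of $n$ nodes with unique identifiers known to the nodes. Nodes have no clocks, they are event-driven (they act on invocations by their own client and on received messages, and handling an event takes no time), and each client has at most one operation under way. Nodes may crash, possibly in the middle of a sequence of send commands. Each ordered pair of nodes is connected by a FIFO channel, which is reliable: a message whose send command has been carried out is eventually received unless the recipient crashes. A snapshot object consists of $n$ segments with given initial values; node $i$ can invoke $\mathrm{Update}(v)$, which writes $v$ into segment $i$, and $\mathrm{Scan}$, which returns a vector with one value per segment. An algorithm implements an *atomic snapshot object* with up to $f$ crashes if in every execution in which at most $f$ nodes crash 1. responses are given only to operations under way (an acknowledgement to an Update, a vector to a Scan); 2. there is an ordering $\sigma$ of all Update and Scan operations such that an operation that completes before another one starts precedes it in $\sigma$, and such that, for every completed Scan and every $j$, the $j$-th entry of the returned vector is the value of the last Update by node $j$ that precedes the Scan in $\sigma$, or the initial value of segment $j$ if there is none; 3. every operation invoked by a node that never crashes completes. **Theorem.** There is a function $T:\mathbb N\to\mathbb R$ with $T(n)=O(\log n)$ such that for all $n$ and $f$ with $f<\frac n2$ (and every set of values and all initial values) there is an algorithm for $n$ nodes that implements an atomic snapshot object with up to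 $f$ crashes and in which every Update and every Scan takes at most $T(n)$ message delays. That is, in every timed execution with at most $f$ crashes, if $D\ge 0$ is such that every message sent by a node that never crashes to a node that never crashes is received within time $D$, then every operation invoked by a node that never crashes completes within time $T(n)\cdot D$ of its invocation. -/

import Mathlib

open Filter Asymptotics

universe u

/-! ## Asynchronous message-passing systems with crash failures

A system has `n` nodes, here numbered by `Fin n`. A node is an event-driven state machine: it reacts
to invocations of operations by its own client and to the reception of messages. It has no clock. -/

/-- What a node does when it handles an event: its new local state, the `send` commands (recipient,
message) that it carries out one after the other, and then possibly a response that is returned to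
its client. -/
structure Reaction (n : ℕ) (State Msg Out : Type u) where
  state : State
  sends : List (Fin n × Msg)
  response : Option Out

/-- A (deterministic) distributed algorithm for `n` nodes. Clients invoke operations in `In`, and
operations return responses in `Out`. -/
structure Protocol (n : ℕ) (In Out : Type u) where
  State : Type u
  Msg : Type u
  init : Fin n → State
  /-- `onInvoke i s x`: node `i` in state `s` handles the invocation of `x` by its client. -/
  onInvoke : Fin n → State → In → Reaction n State Msg Out
  /-- `onReceive j s i m`: node `j` in state `s` handles the message `m` received from node `i`. -/
  onReceive : Fin n → State → Fin n → Msg → Reaction n State Msg Out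

/-- Events of an execution. A node that handles an event may crash while doing so: `cut = some m`
means that it crashes after the first `m` of its `send` commands (and before it returns a response
to the client), `cut = none` means that it handles the event completely. -/
inductive Event (n : ℕ) (In : Type u) where
  /-- the client of node `i` invokes the operation `x` -/
  | invoke (i : Fin n) (x : In) (cut : Option ℕ)
  /-- node `j` receives the first message in transit on the channel from `i` to `j` -/
  | deliver (i j : Fin n) (cut : Option ℕ)
  /-- node `i` crashes between two events -/
  | crash (i : Fin n)
  /-- nothing happens (time may pass) -/
  | idle

namespace Protocol

variable {n : ℕ} {In Out : Type u}

/-- A global configuration. -/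
structure Config (P : Protocol n In Out) where
  /-- local states of the nodes -/
  state : Fin n → P.State
  /-- `chan i j`: the messages in transit from `i` to `j`, oldest first; each one is labelled with
  the index of the event in which it was sent -/
  chan : Fin n → Fin n → List (ℕ × P.Msg)
  /-- the nodes that have crashed -/
  crashed : Finset (Fin n)
  /-- the nodes whose client has an operation that has not returned yet -/
  busy : Finset (Fin n)

/-- The initial configuration. -/
def initConfig (P : Protocol n In Out) : P.Config where
  state := P.init
  chan := fun _ _ => []
  crashed := ∅
  busy := ∅

/-- Node `i` carries out the list `l` of `send` commands in the event with index `k`. -/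
def sendAll {P : Protocol n In Out} (c : P.Config) (k : ℕ) (i : Fin n)
    (l : List (Fin n × P.Msg)) : P.Config :=
  { c with
    chan := fun a b =>
      if a = i then c.chan a b ++ (l.filter (fun p => p.1 = b)).map (fun p => (k, p.2))
      else c.chan a b }

/-- The effect of the reaction `r` of node `i`, in the event with index `k`. -/
def applyReaction {P : Protocol n In Out} (c : P.Config) (k : ℕ) (i : Fin n)
    (r : Reaction n P.State P.Msg Out) (cut : Option ℕ) : P.Config :=
  match cut with
  | none =>
    { sendAll c k i r.sends with
      state := Function.update c.state i r.state
      busy := if r.response.isSome then c.busy.erase i else c.busy }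
  | some m =>
    { sendAll c k i (r.sends.take m) with
      state := Function.update c.state i r.state
      crashed := insert i c.crashed }

/-- The events that may happen in a configuration. A client has at most one operation at a time. -/
def Enabled {P : Protocol n In Out} (c : P.Config) : Event n In → Prop
  | .invoke i _ _ => i ∉ c.crashed ∧ i ∉ c.busy
  | .deliver i j _ => j ∉ c.crashed ∧ c.chan i j ≠ []
  | .crash i => i ∉ c.crashed
  | .idle => True

/-- The configuration after an event, where `k` is the index of the event. -/
def next {P : Protocol n In Out} (c : P.Config) (k : ℕ) : Event n In → P.Config
  | .invoke i x cut =>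
    applyReaction { c with busy := insert i c.busy } k i (P.onInvoke i (c.state i) x) cut
  | .deliver i j cut =>
    match c.chan i j with
    | [] => c
    | (_, m) :: rest =>
      applyReaction
        { c with chan := fun a b => if a = i ∧ b = j then rest else c.chan a b }
        k j (P.onReceive j (c.state j) i m) cut
  | .crash i => { c with crashed := insert i c.crashed }
  | .idle => c

/-- The response (with the node that returns it) that is given to a client in an event, if any. -/
def response {P : Protocol n In Out} (c : P.Config) : Event n In → Option (Fin n × Out)
  | .invoke i x none => (P.onInvoke i (c.state i) x).response.map (fun r => (i, r))
  | .deliver i j none =>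
    match c.chan i j with
    | [] => none
    | (_, m) :: _ => (P.onReceive j (c.state j) i m).response.map (fun r => (j, r))
  | _ => none

/-- The configuration just before the event with index `k`. Finite executions are continued by idle
events. -/
def configAt (P : Protocol n In Out) (ev : ℕ → Event n In) : ℕ → P.Config
  | 0 => P.initConfig
  | k + 1 => next (configAt P ev k) k (ev k)

/-- `ev` is the sequence of events of an execution of `P` in which at most `f` nodes crash. -/
def IsExecution (P : Protocol n In Out) (f : ℕ) (ev : ℕ → Event n In) : Prop :=
  ∀ k, Enabled (P.configAt ev k) (ev k) ∧ (P.configAt ev k).crashed.card ≤ f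

/-- Node `i` never crashes in the execution. -/
def NonFaulty (P : Protocol n In Out) (ev : ℕ → Event n In) (i : Fin n) : Prop :=
  ∀ k, i ∉ (P.configAt ev k).crashed

/-- Channels are reliable: every message that has been sent to a node that does not crash is
eventually received (also if its sender has crashed). -/
def Reliable (P : Protocol n In Out) (ev : ℕ → Event n In) : Prop :=
  ∀ i j, P.NonFaulty ev j → ∀ k t m, (t, m) ∈ (P.configAt ev k).chan i j →
    ∃ k', k ≤ k' ∧ ∀ m', (t, m') ∉ (P.configAt ev k').chan i j

/-- `τ k` is the time of the event with index `k`; time does not go back and grows without bound. -/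
def IsTiming (τ : ℕ → ℝ) : Prop :=
  Monotone τ ∧ Tendsto τ atTop atTop

/-- `D` bounds the message delay: a message from a nonfaulty node to a nonfaulty node that is still
in transit just before an event was sent at most `D` time units before that event. -/
def DelayAtMost (P : Protocol n In Out) (ev : ℕ → Event n In) (τ : ℕ → ℝ) (D : ℝ) : Prop :=
  ∀ i j, P.NonFaulty ev i → P.NonFaulty ev j →
    ∀ k t m, (t, m) ∈ (P.configAt ev k).chan i j → τ k ≤ τ t + D

/-- In the event with index `a`, node `i` invokes the operation `x`. The operations of an execution
are named by these indices. -/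
def Invokes (ev : ℕ → Event n In) (a : ℕ) (i : Fin n) (x : In) : Prop :=
  ∃ cut, ev a = .invoke i x cut

/-- In the event with index `b`, node `i` returns the response `r` to its client. -/
def Returns (P : Protocol n In Out) (ev : ℕ → Event n In) (b : ℕ) (i : Fin n) (r : Out) : Prop :=
  response (P.configAt ev b) (ev b) = some (i, r)

/-- The operation `x` that node `i` invokes in event `a` completes in event `b` with response `r`:
this is the first response of node `i` from event `a` on. -/
def Completes (P : Protocol n In Out) (ev : ℕ → Event n In) (a : ℕ) (i : Fin n) (x : In)
    (b : ℕ) (r : Out) : Prop :=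
  Invokes ev a i x ∧ a ≤ b ∧ P.Returns ev b i r ∧
    ∀ c, a ≤ c → c < b → ∀ r', ¬ P.Returns ev c i r'

/-- Every operation invoked by a node that does not crash completes. -/
def Terminates (P : Protocol n In Out) (f : ℕ) : Prop :=
  ∀ ev, P.IsExecution f ev → P.Reliable ev →
    ∀ a i x, Invokes ev a i x → P.NonFaulty ev i → ∃ b r, P.Completes ev a i x b r

/-- Every operation invoked by a node that does not crash completes within `T` message delays: if
`D` bounds the message delay in an execution, then it completes at most `T * D` time units after its
invocation. Handling an event takes no time. -/
def CompletesWithin (P : Protocol n In Out) (f : ℕ) (T : ℝ) : Prop :=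
  ∀ ev, P.IsExecution f ev → P.Reliable ev →
    ∀ (τ : ℕ → ℝ) (D : ℝ), IsTiming τ → 0 ≤ D → P.DelayAtMost ev τ D →
      ∀ a i x, Invokes ev a i x → P.NonFaulty ev i →
        ∃ b r, P.Completes ev a i x b r ∧ τ b ≤ τ a + T * D

end Protocol

/-! ## Atomic snapshot objects -/

/-- Operations of a (single-writer) snapshot object with one segment per node: `update v` invoked by
node `i` writes `v` into segment `i`. -/
inductive SnapOp (V : Type u) where
  | update (v : V)
  | scan

/-- Responses: an update returns an acknowledgement, a scan returns a vector. -/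
inductive SnapResp (n : ℕ) (V : Type u) where
  | ack
  | view (snap : Fin n → V)

/-- The response has the form that the operation asks for. -/
def SnapOp.Fits {n : ℕ} {V : Type u} : SnapOp V → SnapResp n V → Prop
  | .update _, .ack => True
  | .scan, .view _ => True
  | _, _ => False

namespace Protocol

variable {n : ℕ} {V : Type u}

/-- `lt` orders all operations of the execution `ev` (named by the indices of their invocations) so
that real-time order and the sequential specification of a snapshot object with initial contents
`v₀` are respected. By the real-time condition only finitely many operations precede a completed one,
so that the completed operations and those before them form a sequence. -/
structure IsLinearization (P : Protocol n (SnapOp V) (SnapResp n V)) (v₀ : Fin n → V)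
    (ev : ℕ → Event n (SnapOp V)) (lt : ℕ → ℕ → Prop) : Prop where
  irrefl : ∀ a i x, Invokes ev a i x → ¬ lt a a
  trans : ∀ a i x a' i' x' a'' i'' x'', Invokes ev a i x → Invokes ev a' i' x' →
    Invokes ev a'' i'' x'' → lt a a' → lt a' a'' → lt a a''
  total : ∀ a i x a' i' x', Invokes ev a i x → Invokes ev a' i' x' → a ≠ a' → lt a a' ∨ lt a' a
  /-- an operation that completes before another one starts comes before it -/
  real_time : ∀ a i x b r a' i' x', P.Completes ev a i x b r → Invokes ev a' i' x' → b < a' →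
    lt a a'
  /-- a scan returns, for each segment `j`, the value of the last update by `j` that precedes it, or
  the initial value if there is none -/
  scan_spec : ∀ a i b snap, P.Completes ev a i .scan b (.view snap) → ∀ j,
    (∃ u, Invokes ev u j (.update (snap j)) ∧ lt u a ∧
      ∀ u' w, Invokes ev u' j (.update w) → lt u' a → u' ≠ u → lt u' u) ∨
    ((∀ u w, Invokes ev u j (.update w) → ¬ lt u a) ∧ snap j = v₀ j)

/-- `P` implements an atomic (linearizable) snapshot object with initial contents `v₀` if at most
`f` nodes crash: responses are given only to operations that are under way and have the right form,
every execution is linearizable, and operations of nodes that do not crash terminate. -/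
structure IsAtomicSnapshot (P : Protocol n (SnapOp V) (SnapResp n V)) (f : ℕ) (v₀ : Fin n → V) :
    Prop where
  wellFormed : ∀ ev, P.IsExecution f ev → ∀ b i r, P.Returns ev b i r →
    ∃ a x, P.Completes ev a i x b r ∧ x.Fits r
  linearizable : ∀ ev, P.IsExecution f ev → ∃ lt, P.IsLinearization v₀ ev lt
  terminates : P.Terminates f

end Protocol

/-! The nodes run a full-information protocol whose operations are sequences of exchanges: a node
sends all its knowledge to everyone and waits for replies from a majority. Since a majority is
nonfaulty, an exchange costs at most two message delays (`exchange_time`). Any two majorities share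
a node. Hence of any two exchanges, one ends with all the knowledge that the other started with
(`Exchange.comparable`), and an exchange learns whatever an earlier one started with
(`Exchange.of_le`).

The views of operations are sets of updates, produced in numbered rounds of lattice agreement. In a
round, nodes descend a binary tree of depth `L = ⌈log₂ n⌉`. At a vertex a node announces its set of
inputs and counts the inputs announced there. If the count is at most a threshold, it goes to the
`false` child with its set unchanged; otherwise it makes one more exchange and goes to the `true`
child with all inputs collected. The range of possible cardinalities halves at each level, so all
sets at a leaf coincide, and every input that goes to `false` lies in every set that goes to `true`.
Thus the results of a round form a chain (`leaf_comparable`). A level costs at most three exchanges,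
which gives the logarithm.

A node joins the round after the latest one that it knows to be completed. Before recording an
output it lets a majority know the updates in it and checks that it still knows no completion of
this or a later round. Therefore the inputs of all later rounds contain the output (`subset_input`),
and outputs of all rounds form a chain (`fin_comparable`). A node that finds its round completed by
others tries once more; if this happens again, it knows a completed round that is late enough to
contain its own update and all views completed before its invocation, and adopts that output. So
every view contains these updates (`exists_view`), and a chain of such views yields a linearization
(`isLinearization_viewLT`).

Local correctness of the program is phrased with weakest preconditions, and `sound` transfers it to
all executions. -/

namespace Protocol

/-! ### Single steps of executions, and the pairing of invocations with responses. -/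

section Trace

variable {n : ℕ} {In Out : Type u} {P : Protocol n In Out} {f : ℕ} {ev : ℕ → Event n In}

/-- In event `k`, node `j` handles an invocation or a message with reaction `R`. -/
inductive Handles (P : Protocol n In Out) (ev : ℕ → Event n In) (k : ℕ) (j : Fin n) :
    Reaction n P.State P.Msg Out → Option ℕ → Prop
  | invoke (x : In) (cut : Option ℕ) (h : ev k = .invoke j x cut) :
      Handles P ev k j (P.onInvoke j ((P.configAt ev k).state j) x) cut
  | deliver (i : Fin n) (cut : Option ℕ) (t : ℕ) (m : P.Msg) (rest : List (ℕ × P.Msg))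
      (h : ev k = .deliver i j cut) (hc : (P.configAt ev k).chan i j = (t, m) :: rest) :
      Handles P ev k j (P.onReceive j ((P.configAt ev k).state j) i m) cut

@[simp] theorem applyReaction_state (c : P.Config) (k : ℕ) (i : Fin n)
    (r : Reaction n P.State P.Msg Out) (cut : Option ℕ) :
    (applyReaction c k i r cut).state = Function.update c.state i r.state := by
  cases cut <;> rfl

theorem mem_sendAll {c : P.Config} {k : ℕ} {i : Fin n} {l : List (Fin n × P.Msg)} {a b : Fin n}
    {t : ℕ} {m : P.Msg} :
    (t, m) ∈ (sendAll c k i l).chan a b ↔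
      (t, m) ∈ c.chan a b ∨ (a = i ∧ t = k ∧ (b, m) ∈ l) := by
  unfold sendAll
  by_cases h : a = i
  · subst h
    simp only [if_true, List.mem_append, List.mem_map, List.mem_filter, true_and]
    constructor
    · rintro (h | ⟨⟨b', m'⟩, ⟨h, hb⟩, he⟩)
      · exact .inl h
      · simp only [Prod.mk.injEq, decide_eq_true_eq] at he hb
        obtain ⟨rfl, rfl⟩ := he
        subst hb
        exact .inr ⟨rfl, h⟩
    · rintro (h | ⟨rfl, h⟩)
      · exact .inl h
      · exact .inr ⟨(b, m), ⟨h, by simp⟩, rfl⟩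
  · simp [h]

theorem mem_chan_applyReaction {c : P.Config} {k : ℕ} {i : Fin n}
    {r : Reaction n P.State P.Msg Out} {cut : Option ℕ} {a b : Fin n} {t : ℕ} {m : P.Msg}
    (h : (t, m) ∈ (applyReaction c k i r cut).chan a b) :
    (t, m) ∈ c.chan a b ∨ (a = i ∧ t = k ∧ (b, m) ∈ r.sends) := by
  cases cut with
  | none => exact mem_sendAll.1 h
  | some l =>
    rcases mem_sendAll.1 h with h | ⟨h1, h2, h3⟩
    · exact .inl h
    · exact .inr ⟨h1, h2, List.mem_of_mem_take h3⟩

theorem chan_applyReaction_of_mem {c : P.Config} {k : ℕ} {i : Fin n}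
    {r : Reaction n P.State P.Msg Out} {cut : Option ℕ} {a b : Fin n} {t : ℕ} {m : P.Msg}
    (h : (t, m) ∈ c.chan a b) : (t, m) ∈ (applyReaction c k i r cut).chan a b := by
  cases cut <;> exact mem_sendAll.2 (.inl h)

theorem state_of_handles {k : ℕ} {j : Fin n} {R : Reaction n P.State P.Msg Out} {cut : Option ℕ}
    (h : Handles P ev k j R cut) : (P.configAt ev (k + 1)).state j = R.state := by
  cases h with
  | invoke x cut h => simp [configAt, next, h]
  | deliver i cut t m rest h hc => simp [configAt, next, h, hc]

theorem state_succ (k : ℕ) (j : Fin n) :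
    (P.configAt ev (k + 1)).state j = (P.configAt ev k).state j ∨
      ∃ R cut, Handles P ev k j R cut := by
  rcases hev : ev k with ⟨i, x, cut⟩ | ⟨i, l, cut⟩ | ⟨i⟩ | _
  · by_cases hij : j = i
    · subst hij; exact .inr ⟨_, _, .invoke x cut hev⟩
    · left; simp [configAt, next, hev, hij]
  · by_cases hij : j = l
    · subst hij
      rcases hc : (P.configAt ev k).chan i j with _ | ⟨⟨t, m⟩, rest⟩
      · left; simp [configAt, next, hev, hc]
      · exact .inr ⟨_, _, .deliver i cut t m rest hev hc⟩
    · left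
      rcases hc : (P.configAt ev k).chan i l with _ | ⟨⟨t, m⟩, rest⟩
      · simp [configAt, next, hev, hc]
      · simp [configAt, next, hev, hc, hij]
  · left; simp [configAt, next, hev]
  · left; simp [configAt, next, hev]

theorem mem_chan_succ {k : ℕ} {i j : Fin n} {t : ℕ} {m : P.Msg}
    (h : (t, m) ∈ (P.configAt ev (k + 1)).chan i j) :
    (t, m) ∈ (P.configAt ev k).chan i j ∨
      (t = k ∧ ∃ R cut, Handles P ev k i R cut ∧ (j, m) ∈ R.sends) := by
  rcases hev : ev k with ⟨a, x, cut⟩ | ⟨a, b, cut⟩ | ⟨a⟩ | _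
  · simp only [configAt, next, hev] at h
    rcases mem_chan_applyReaction h with h | ⟨rfl, h2, h3⟩
    · exact .inl h
    · exact .inr ⟨h2, _, _, .invoke x cut hev, h3⟩
  · rcases hc : (P.configAt ev k).chan a b with _ | ⟨⟨t', m'⟩, rest⟩
    · left; simpa [configAt, next, hev, hc] using h
    · simp only [configAt, next, hev, hc] at h
      rcases mem_chan_applyReaction h with h' | ⟨rfl, h2, h3⟩
      · left
        by_cases hab : i = a ∧ j = b
        · obtain ⟨rfl, rfl⟩ := hab
          rw [hc]; exact List.mem_cons_of_mem _ (by simpa using h')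
        · simpa [hab] using h'
      · exact .inr ⟨h2, _, _, .deliver a cut t' m' rest hev hc, h3⟩
  · left; simpa [configAt, next, hev] using h
  · left; simpa [configAt, next, hev] using h

theorem chan_of_send {k : ℕ} {i j : Fin n} {R : Reaction n P.State P.Msg Out} {m : P.Msg}
    (h : Handles P ev k i R none) (hm : (j, m) ∈ R.sends) :
    (k, m) ∈ (P.configAt ev (k + 1)).chan i j := by
  cases h with
  | invoke x _ h =>
    simp only [configAt, next, h]
    exact mem_sendAll.2 (.inr ⟨rfl, rfl, hm⟩)
  | deliver i' _ t m' rest h hc =>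
    simp only [configAt, next, h, hc]
    exact mem_sendAll.2 (.inr ⟨rfl, rfl, hm⟩)

theorem chan_keep {k : ℕ} {i j : Fin n} {t : ℕ} {m : P.Msg}
    (h : (t, m) ∈ (P.configAt ev k).chan i j) :
    (t, m) ∈ (P.configAt ev (k + 1)).chan i j ∨
      ∃ cut rest, ev k = .deliver i j cut ∧ (P.configAt ev k).chan i j = (t, m) :: rest := by
  rcases hev : ev k with ⟨a, x, cut⟩ | ⟨a, b, cut⟩ | ⟨a⟩ | _
  · left
    simp only [configAt, next, hev]
    exact chan_applyReaction_of_mem h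
  · rcases hc : (P.configAt ev k).chan a b with _ | ⟨⟨t', m'⟩, rest⟩
    · left; simpa [configAt, next, hev, hc] using h
    · by_cases hab : i = a ∧ j = b
      · obtain ⟨rfl, rfl⟩ := hab
        rw [hc] at h
        rcases List.mem_cons.1 h with h | h
        · right; exact ⟨cut, rest, rfl, by rw [hc, h]⟩
        · left
          simp only [configAt, next, hev, hc]
          apply chan_applyReaction_of_mem
          simpa using h
      · left
        simp only [configAt, next, hev, hc]
        apply chan_applyReaction_of_mem
        simpa [hab] using h
  · left; simpa [configAt, next, hev] using h
  · left; simpa [configAt, next, hev] using h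

/-- New messages carry the index of the current event, so a past label cannot come back to a
channel. -/
theorem label_gone {k k' : ℕ} {i j : Fin n} {t : ℕ} (ht : t < k) (hk : k ≤ k')
    (h : ∀ m, (t, m) ∉ (P.configAt ev k).chan i j) :
    ∀ m, (t, m) ∉ (P.configAt ev k').chan i j := by
  induction k', hk using Nat.le_induction with
  | base => exact h
  | succ k' hk ih =>
    intro m hm
    rcases mem_chan_succ hm with hm | ⟨rfl, -⟩
    · exact ih m hm
    · omega

theorem crashed_succ (k : ℕ) :
    (P.configAt ev k).crashed ⊆ (P.configAt ev (k + 1)).crashed := by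
  rcases hev : ev k with ⟨i, x, cut⟩ | ⟨i, l, cut⟩ | ⟨i⟩ | _
  · cases cut <;> simp [configAt, next, hev, applyReaction, sendAll]
  · rcases hc : (P.configAt ev k).chan i l with _ | ⟨⟨t, m⟩, rest⟩
    · simp [configAt, next, hev, hc]
    · cases cut <;> simp [configAt, next, hev, hc, applyReaction, sendAll]
  · simp [configAt, next, hev]
  · simp [configAt, next, hev]

theorem crashed_mono : Monotone fun k => (P.configAt ev k).crashed :=
  monotone_nat_of_le_succ crashed_succ

theorem crashed_of_handles {k : ℕ} {j : Fin n} {R : Reaction n P.State P.Msg Out} {l : ℕ}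
    (h : Handles P ev k j R (some l)) : j ∈ (P.configAt ev (k + 1)).crashed := by
  cases h with
  | invoke x cut h => simp [configAt, next, h, applyReaction]
  | deliver i cut t m rest h hc => simp [configAt, next, h, hc, applyReaction]

theorem NonFaulty.cut_eq {k : ℕ} {j : Fin n} {R : Reaction n P.State P.Msg Out} {cut : Option ℕ}
    (hj : P.NonFaulty ev j) (h : Handles P ev k j R cut) : cut = none := by
  cases cut with
  | none => rfl
  | some l => exact absurd (crashed_of_handles h) (hj _)

theorem Handles.returns {k : ℕ} {j : Fin n} {R : Reaction n P.State P.Msg Out} {r : Out}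
    (h : Handles P ev k j R none) (hr : R.response = some r) : P.Returns ev k j r := by
  cases h with
  | invoke x cut h => simp [Returns, response, h, hr]
  | deliver i cut t m rest h hc => simp [Returns, response, h, hc, hr]

theorem Returns.handles {k : ℕ} {j : Fin n} {r : Out} (h : P.Returns ev k j r) :
    ∃ R, Handles P ev k j R none ∧ R.response = some r := by
  unfold Returns at h
  rcases hev : ev k with ⟨i, x, _ | l⟩ | ⟨i, l, _ | c⟩ | ⟨i⟩ | _
  · simp only [hev, response, Option.map_eq_some_iff, Prod.mk.injEq] at h
    obtain ⟨r', h1, rfl, rfl⟩ := h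
    exact ⟨_, .invoke x none hev, h1⟩
  · simp [hev, response] at h
  · rcases hc : (P.configAt ev k).chan i l with _ | ⟨⟨t, m⟩, rest⟩
    · simp [hev, response, hc] at h
    · simp only [hev, response, hc, Option.map_eq_some_iff, Prod.mk.injEq] at h
      obtain ⟨r', h1, rfl, rfl⟩ := h
      exact ⟨_, .deliver i none t m rest hev hc, h1⟩
  · simp [hev, response] at h
  · simp [hev, response] at h
  · simp [hev, response] at h

theorem handles_unique {k : ℕ} {j j' : Fin n} {R R' : Reaction n P.State P.Msg Out}
    {cut cut' : Option ℕ} (h : Handles P ev k j R cut) (h' : Handles P ev k j' R' cut') :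
    j = j' ∧ R = R' ∧ cut = cut' := by
  cases h with
  | invoke x cut h =>
    cases h' with
    | invoke x' cut' h' => rw [h] at h'; cases h'; exact ⟨rfl, rfl, rfl⟩
    | deliver i' cut' t' m' rest' h' hc' => rw [h] at h'; cases h'
  | deliver i cut t m rest h hc =>
    cases h' with
    | invoke x' cut' h' => rw [h] at h'; cases h'
    | deliver i' cut' t' m' rest' h' hc' =>
      rw [h] at h'; cases h'
      rw [hc] at hc'; cases hc'
      exact ⟨rfl, rfl, rfl⟩

theorem Returns.unique {k : ℕ} {j j' : Fin n} {r r' : Out} (h : P.Returns ev k j r)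
    (h' : P.Returns ev k j' r') : j = j' ∧ r = r' := by
  unfold Returns at h h'
  rw [h] at h'
  cases h'; exact ⟨rfl, rfl⟩

theorem busy_succ {k : ℕ} {i : Fin n} (h : i ∈ (P.configAt ev k).busy) :
    i ∈ (P.configAt ev (k + 1)).busy ∨ ∃ r, P.Returns ev k i r := by
  rcases hev : ev k with ⟨a, x, _ | l⟩ | ⟨a, b, cut⟩ | ⟨a⟩ | _
  · rcases hr : (P.onInvoke a ((P.configAt ev k).state a) x).response with _ | r
    · left; simp [configAt, next, hev, applyReaction, sendAll, hr, h]
    · by_cases hia : i = a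
      · subst hia
        exact .inr ⟨r, (Handles.invoke x none hev).returns hr⟩
      · left; simp [configAt, next, hev, applyReaction, sendAll, hr, h, hia]
  · left; simp [configAt, next, hev, applyReaction, sendAll, h]
  · rcases hc : (P.configAt ev k).chan a b with _ | ⟨⟨t, m⟩, rest⟩
    · left; simpa [configAt, next, hev, hc] using h
    · cases cut with
      | some l => left; simp [configAt, next, hev, hc, applyReaction, sendAll, h]
      | none =>
        rcases hr : (P.onReceive b ((P.configAt ev k).state b) a m).response with _ | r
        · left; simp [configAt, next, hev, hc, applyReaction, sendAll, hr, h]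
        · by_cases hib : i = b
          · subst hib
            exact .inr ⟨r, (Handles.deliver a none t m rest hev hc).returns hr⟩
          · left; simp [configAt, next, hev, hc, applyReaction, sendAll, hr, h, hib]
  · left; simpa [configAt, next, hev] using h
  · left; simpa [configAt, next, hev] using h

theorem busy_of_invokes {a : ℕ} {i : Fin n} {x : In} (h : Invokes ev a i x) :
    i ∈ (P.configAt ev (a + 1)).busy ∨ ∃ r, P.Returns ev a i r := by
  obtain ⟨_ | l, h⟩ := h
  · rcases hr : (P.onInvoke i ((P.configAt ev a).state i) x).response with _ | r
    · left; simp [configAt, next, h, applyReaction, sendAll, hr]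
    · exact .inr ⟨r, (Handles.invoke x none h).returns hr⟩
  · left; simp [configAt, next, h, applyReaction, sendAll]

theorem busy_of_no_return {a k : ℕ} {i : Fin n} {x : In} (h : Invokes ev a i x) (hk : a < k)
    (hn : ∀ c, a ≤ c → c < k → ∀ r, ¬ P.Returns ev c i r) : i ∈ (P.configAt ev k).busy := by
  induction k, hk using Nat.le_induction with
  | base =>
    rcases P.busy_of_invokes h with h | ⟨r, h⟩
    · exact h
    · exact absurd h (hn a le_rfl (Nat.lt_succ_self a) r)
  | succ k hk ih =>
    rcases busy_succ (ih fun c h1 h2 => hn c h1 (h2.trans (Nat.lt_succ_self k))) with h | ⟨r, h⟩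
    · exact h
    · exact absurd h (hn k (by omega) (Nat.lt_succ_self k) r)

theorem Invokes.unique {a : ℕ} {i i' : Fin n} {x x' : In} (h : Invokes ev a i x)
    (h' : Invokes ev a i' x') : i = i' ∧ x = x' := by
  obtain ⟨c, h⟩ := h
  obtain ⟨c', h'⟩ := h'
  rw [h] at h'; cases h'; exact ⟨rfl, rfl⟩

/-- Between two invocations at the same node, the first operation completes. -/
theorem exists_completes_of_invokes (hex : P.IsExecution f ev) {a a' : ℕ} {i : Fin n} {x x' : In}
    (h : Invokes ev a i x) (h' : Invokes ev a' i x') (haa : a < a') :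
    ∃ b r, P.Completes ev a i x b r ∧ b < a' := by
  classical
  have hnb : i ∉ (P.configAt ev a').busy := by
    obtain ⟨c, h'⟩ := h'
    have := (hex a').1
    rw [h'] at this
    exact this.2
  -- Only a response removes a node from `busy`; the first one from `a` on is the completion.
  have hex2 : ∃ c, a ≤ c ∧ c < a' ∧ ∃ r, P.Returns ev c i r := by
    by_contra hcon
    push Not at hcon
    exact hnb (busy_of_no_return h haa hcon)
  obtain ⟨h1, h2, r, hr⟩ := Nat.find_spec hex2
  refine ⟨Nat.find hex2, r, ⟨h, h1, hr, fun c hc1 hc2 r' hr' => ?_⟩, h2⟩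
  exact Nat.find_min hex2 hc2 ⟨hc1, hc2.trans h2, r', hr'⟩

/-- The earlier of two operations of a node returns before the later one is invoked, so they cannot
share their first response. -/
theorem Completes.inv_unique (hex : P.IsExecution f ev) {a a' b : ℕ} {i : Fin n} {x x' : In}
    {r r' : Out} (h : P.Completes ev a i x b r) (h' : P.Completes ev a' i x' b r') : a = a' := by
  rcases lt_trichotomy a a' with hlt | heq | hlt
  · obtain ⟨c, s, hc, hca⟩ := exists_completes_of_invokes hex h.1 h'.1 hlt
    exact absurd hc.2.2.1 (h.2.2.2 c hc.2.1 (hca.trans_le h'.2.1) s)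
  · exact heq
  · obtain ⟨c, s, hc, hca⟩ := exists_completes_of_invokes hex h'.1 h.1 hlt
    exact absurd hc.2.2.1 (h'.2.2.2 c hc.2.1 (hca.trans_le h.2.1) s)

theorem Completes.out_unique {a b b' : ℕ} {i i' : Fin n} {x x' : In}
    {r r' : Out} (h : P.Completes ev a i x b r) (h' : P.Completes ev a i' x' b' r') :
    i = i' ∧ x = x' ∧ b = b' ∧ r = r' := by
  obtain ⟨rfl, rfl⟩ := h.1.unique h'.1
  rcases lt_trichotomy b b' with hlt | rfl | hlt
  · exact absurd h.2.2.1 (h'.2.2.2 b h.2.1 hlt r)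
  · exact ⟨rfl, rfl, rfl, (h.2.2.1.unique h'.2.2.1).2⟩
  · exact absurd h'.2.2.1 (h.2.2.2 b' h'.2.1 hlt r')

/-- A message in transit to a nonfaulty node is eventually received. -/
theorem exists_deliver (hrel : P.Reliable ev) {i j : Fin n} (hj : P.NonFaulty ev j) {k t : ℕ}
    {m : P.Msg} (h : (t, m) ∈ (P.configAt ev k).chan i j) :
    ∃ k' rest, k ≤ k' ∧ ev k' = .deliver i j none ∧
      (P.configAt ev k').chan i j = (t, m) :: rest := by
  obtain ⟨k', hk, hgone⟩ := hrel i j hj k t m h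
  by_contra hcon
  push Not at hcon
  refine hgone m ?_
  clear hgone
  induction k', hk using Nat.le_induction with
  | base => exact h
  | succ l hl ih =>
    rcases chan_keep ih with h' | ⟨cut, rest, h1, h2⟩
    · exact h'
    · have := hj.cut_eq (Handles.deliver i cut t m rest h1 h2)
      subst this
      exact absurd h2 (hcon l rest (by omega) h1)

end Trace

/-! ### Termination from time bounds. -/

section Termination

variable {n : ℕ} {In Out : Type u} {P : Protocol n In Out} {f : ℕ} {ev : ℕ → Event n In}

/-- In a reliable execution, events can be timed such that message delays are at most one. -/
theorem exists_timing (hrel : P.Reliable ev) :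
    ∃ τ : ℕ → ℝ, IsTiming τ ∧ P.DelayAtMost ev τ 1 := by
  classical
  -- By event `R t`, all messages sent in event `t` to nonfaulty nodes have left their channels.
  have hR : ∀ t, ∃ R, t < R ∧ ∀ i j, P.NonFaulty ev j → ∀ k, R ≤ k → ∀ m,
      (t, m) ∉ (P.configAt ev k).chan i j := by
    intro t
    have h1 : ∀ p : Fin n × Fin n, ∃ R, t < R ∧ (P.NonFaulty ev p.2 → ∀ m,
        (t, m) ∉ (P.configAt ev R).chan p.1 p.2) := by
      intro p
      by_cases hp : P.NonFaulty ev p.2 ∧ ∃ m, (t, m) ∈ (P.configAt ev (t + 1)).chan p.1 p.2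
      · obtain ⟨hp, m, hm⟩ := hp
        obtain ⟨k', hk, h⟩ := hrel p.1 p.2 hp _ _ _ hm
        exact ⟨k', by omega, fun _ => h⟩
      · refine ⟨t + 1, by omega, fun h m hm => hp ⟨h, m, hm⟩⟩
    choose R hR1 hR2 using h1
    refine ⟨Finset.univ.sup R + t + 1, by omega, fun i j hj k hk => ?_⟩
    have : R (i, j) ≤ Finset.univ.sup R := Finset.le_sup (Finset.mem_univ (i, j))
    exact label_gone (hR1 (i, j)) (by omega) (hR2 (i, j) hj)
  choose R hR1 hR2 using hR
  -- Cut the events into blocks starting at `s l`, such that messages sent up to event `s l` are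
  -- received before `s (l + 1)`. The time `g k` is the number of the block of event `k`, so a
  -- message sent in one block is received at the latest in the next.
  obtain ⟨s, hs0, hs⟩ : ∃ s : ℕ → ℕ, s 0 = 0 ∧
      ∀ l, s (l + 1) = (Finset.range (s l + 1)).sup R + s l + 1 :=
    ⟨fun l => Nat.rec (motive := fun _ => ℕ) 0
      (fun _ x => (Finset.range (x + 1)).sup R + x + 1) l, rfl, fun _ => rfl⟩
  have hsm : StrictMono s := strictMono_nat_of_lt_succ fun l => by rw [hs]; omega
  let g : ℕ → ℕ := fun k => Nat.findGreatest (fun l : ℕ => s l ≤ k) k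
  have hg1 : ∀ k, s (g k) ≤ k := fun k =>
    Nat.findGreatest_spec (m := 0) (n := k) (P := fun l : ℕ => s l ≤ k) (Nat.zero_le k)
      (by rw [hs0]; exact Nat.zero_le k)
  have hg2 : ∀ k l, s l ≤ k → l ≤ g k := fun k l h =>
    Nat.le_findGreatest (P := fun l : ℕ => s l ≤ k) (hsm.le_apply.trans h) h
  have hg3 : ∀ k, k < s (g k + 1) := fun k => by
    by_contra h
    have := hg2 k _ (not_lt.1 h)
    omega
  have hgm : Monotone g := fun a b hab => hg2 b _ ((hg1 a).trans hab)
  refine ⟨fun k => (g k : ℝ), ⟨fun a b hab => Nat.cast_le.2 (hgm hab), ?_⟩, ?_⟩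
  · refine tendsto_natCast_atTop_atTop.comp (tendsto_atTop_atTop.2 fun b => ⟨s b, fun a ha => ?_⟩)
    exact hg2 a b ha
  · intro i j _ hj k t m hm
    have hkR : k < R t := by
      by_contra h
      exact hR2 t i j hj k (not_lt.1 h) m hm
    have h1 : R t ≤ (Finset.range (s (g t + 1) + 1)).sup R :=
      Finset.le_sup (Finset.mem_range.2 ((hg3 t).trans (Nat.lt_succ_self _)))
    have h2 : k < s (g t + 1 + 1) := by rw [hs (g t + 1)]; omega
    have h3 : g k < g t + 1 + 1 := by
      by_contra h
      have := hsm.monotone (not_lt.1 h)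
      have := hg1 k
      omega
    have h4 : g k ≤ g t + 1 := by omega
    show (g k : ℝ) ≤ g t + 1
    exact_mod_cast h4

/-- A time bound says nothing about untimed executions by itself; `exists_timing` supplies a timing
with `D = 1`. -/
theorem CompletesWithin.terminates {T : ℝ} (h : P.CompletesWithin f T) : P.Terminates f := by
  intro ev hex hrel a i x ha hi
  obtain ⟨τ, h1, h2⟩ := exists_timing hrel
  obtain ⟨b, r, hb, -⟩ := h ev hex hrel τ 1 h1 zero_le_one h2 a i x ha hi
  exact ⟨b, r, hb⟩

end Termination

end Protocol

/-! ## Full-information protocols that run programs of quorum exchanges -/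

/-- A program of a client operation: it adds facts to the knowledge of its node and then returns a
response, or exchanges all knowledge with a majority of the nodes and continues depending on the
knowledge that its node has afterwards. -/
inductive Prog (F Out : Type u) : Type u where
  | ret (add : Set F) (o : Out)
  | xch (add : Set F) (c : Set F → Prog F Out)

/-- A request to take note of some knowledge, or a reply to such a request. -/
structure XMsg (F : Type u) : Type u where
  isReq : Bool
  tag : ℕ
  know : Set F

/-- The state of a node: its knowledge, the tag of its latest exchange with the knowledge at its
start and the nodes that have replied, the number of operations so far, and the continuation of the
operation that is under way. -/
structure XState (n : ℕ) (F Out : Type u) : Type u where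
  know : Set F
  tag : ℕ
  kst : Set F
  acks : Finset (Fin n)
  cnt : ℕ
  cont : Option (Set F → Prog F Out)

namespace XState

variable {n : ℕ} {F Out : Type u}

/-- Run a program up to its next exchange. -/
def run (s : XState n F Out) : Prog F Out → Reaction n (XState n F Out) (XMsg F) Out
  | .ret add o => ⟨{ s with know := s.know ∪ add, cont := none }, [], some o⟩
  | .xch add c =>
    ⟨{ s with
        know := s.know ∪ add, tag := s.tag + 1, kst := s.know ∪ add, acks := ∅, cont := some c },
      (List.finRange n).map fun j => (j, ⟨true, s.tag + 1, s.know ∪ add⟩), none⟩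

/-- Take note of the knowledge in a message. -/
def absorb (s : XState n F Out) (m : XMsg F) : XState n F Out :=
  { s with know := s.know ∪ m.know }

/-- The reaction to a message from node `i`. -/
def receive (s : XState n F Out) (i : Fin n) (m : XMsg F) :
    Reaction n (XState n F Out) (XMsg F) Out :=
  if m.isReq then ⟨s.absorb m, [(i, ⟨false, m.tag, s.know ∪ m.know⟩)], none⟩
  else
    match s.cont with
    | none => ⟨s.absorb m, [], none⟩
    | some c =>
      if m.tag = s.tag then
        if n < 2 * (insert i s.acks).card then (s.absorb m).run (c (s.know ∪ m.know))
        else ⟨{ s.absorb m with acks := insert i s.acks }, [], none⟩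
      else ⟨s.absorb m, [], none⟩

end XState

/-- The protocol in which node `i` runs the program `prog i c x` for its operation `x`, where `c` is
the number of its earlier operations. -/
@[reducible] def xchProtocol {n : ℕ} {F In Out : Type u} (prog : Fin n → ℕ → In → Prog F Out) :
    Protocol n In Out where
  State := XState n F Out
  Msg := XMsg F
  init := fun _ => ⟨∅, 0, ∅, ∅, 0, none⟩
  onInvoke := fun i s x => { s with cnt := s.cnt + 1 }.run (prog i s.cnt x)
  onReceive := fun _ s i m => s.receive i m

/-! ### Quorum exchanges and majority intersection. -/

section Exchange

variable {n : ℕ} {F : Type u}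

/-- Between the times `s` and `e`, a majority of nodes came to know `Ks`, and all that they knew at
that time is in `Ke`. Here `Kn k j` is the knowledge of node `j` at time `k`. -/
def Exchange (Kn : ℕ → Fin n → Set F) (s e : ℕ) (Ks Ke : Set F) : Prop :=
  ∃ Q : Finset (Fin n), n < 2 * Q.card ∧
    ∀ j ∈ Q, ∃ h, s ≤ h ∧ h ≤ e ∧ Ks ⊆ Kn h j ∧ Kn h j ⊆ Ke

variable {Kn : ℕ → Fin n → Set F} {s e s' e' : ℕ} {Ks Ke Ks' Ke' : Set F}

theorem exists_mem_inter_of_majority {Q Q' : Finset (Fin n)} (h : n < 2 * Q.card)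
    (h' : n < 2 * Q'.card) : ∃ j, j ∈ Q ∧ j ∈ Q' := by
  by_contra hcon
  push Not at hcon
  have hd : Disjoint Q Q' := Finset.disjoint_left.2 hcon
  have h1 := Finset.card_le_univ (Q ∪ Q')
  rw [Finset.card_union_of_disjoint hd, Fintype.card_fin] at h1
  omega

theorem Exchange.subset (h : Exchange Kn s e Ks Ke) : Ks ⊆ Ke := by
  obtain ⟨Q, hQ, h⟩ := h
  obtain ⟨j, hj, -⟩ := exists_mem_inter_of_majority hQ hQ
  obtain ⟨t, -, -, h1, h2⟩ := h j hj
  exact h1.trans h2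

/-- A node common to both majorities took part in one exchange no later than in the other, and its
knowledge only grows. -/
theorem Exchange.comparable (hmono : ∀ j, Monotone fun k => Kn k j) (h : Exchange Kn s e Ks Ke)
    (h' : Exchange Kn s' e' Ks' Ke') : Ks ⊆ Ke' ∨ Ks' ⊆ Ke := by
  obtain ⟨Q, hQ, h⟩ := h
  obtain ⟨Q', hQ', h'⟩ := h'
  obtain ⟨j, hj, hj'⟩ := exists_mem_inter_of_majority hQ hQ'
  obtain ⟨t, -, -, h1, h2⟩ := h j hj
  obtain ⟨t', -, -, h1', h2'⟩ := h' j hj'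
  rcases le_total t t' with htt | htt
  · exact .inl ((h1.trans (hmono j htt)).trans h2')
  · exact .inr ((h1'.trans (hmono j htt)).trans h2)

/-- The common node takes part in the first exchange before it takes part in the second. -/
theorem Exchange.of_le (hmono : ∀ j, Monotone fun k => Kn k j) (h : Exchange Kn s e Ks Ke)
    (h' : Exchange Kn s' e' Ks' Ke') (he : e ≤ s') : Ks ⊆ Ke' := by
  obtain ⟨Q, hQ, h⟩ := h
  obtain ⟨Q', hQ', h'⟩ := h'
  obtain ⟨j, hj, hj'⟩ := exists_mem_inter_of_majority hQ hQ'
  obtain ⟨t, -, ht, h1, h2⟩ := h j hj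
  obtain ⟨t', ht', -, h1', h2'⟩ := h' j hj'
  exact (h1.trans (hmono j (ht.trans (he.trans ht')))).trans h2'

end Exchange

/-! ### Weakest preconditions for programs of exchanges. -/

/-- Assertions about an execution, whose nodes have knowledge `Kn`: `OK k φ` is what holds for facts
`φ` known before event `k`, `own φ i` means that only node `i` may create `φ`, `Idle i K` is what
holds for the knowledge `K` of a node `i` between operations, and `Post i a x b o` is what holds when
the operation `x` invoked in event `a` returns `o` in event `b`. -/
structure Assertions (n : ℕ) (F In Out : Type u) where
  Kn : ℕ → Fin n → Set F
  OK : ℕ → F → Prop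
  own : F → Fin n → Prop
  Idle : Fin n → Set F → Prop
  Post : Fin n → ℕ → In → ℕ → Out → Prop

namespace Assertions

variable {n : ℕ} {F In Out : Type u}

/-- The weakest precondition for running a program in event `t` with knowledge `K`, at node `i` as
part of its operation `x` that was invoked in event `a`. -/
def wp (S : Assertions n F In Out) (i : Fin n) (a : ℕ) (x : In) : Prog F Out → ℕ → Set F → Prop
  | .ret add o, t, K => S.Kn (t + 1) i = K ∪ add →
    (∀ φ ∈ add, S.OK (t + 1) φ ∧ ∀ p, S.own φ p → p = i) ∧ S.Idle i (K ∪ add) ∧ S.Post i a x t o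
  | .xch add c, t, K => S.Kn (t + 1) i = K ∪ add →
    (∀ φ ∈ add, S.OK (t + 1) φ ∧ ∀ p, S.own φ p → p = i) ∧
    ∀ e Ke, t < e → Exchange S.Kn (t + 1) e (K ∪ add) Ke → S.Kn e i ⊆ Ke → Ke ⊆ S.Kn (e + 1) i →
      (∀ φ ∈ Ke, S.OK e φ) → (∀ φ ∈ Ke, S.own φ i → φ ∈ K ∪ add) → S.wp i a x (c Ke) e Ke

end Assertions

/-! ### Analysis of the steps of the exchange protocol. -/

namespace XProtocol

open Protocol

variable {n : ℕ} {F In Out : Type u} {prog : Fin n → ℕ → In → Prog F Out} {f : ℕ}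
  {ev : ℕ → Event n In}

/-- The state of node `i` before event `k`. -/
abbrev st (prog : Fin n → ℕ → In → Prog F Out) (ev : ℕ → Event n In) (k : ℕ) (i : Fin n) :
    XState n F Out :=
  ((xchProtocol prog).configAt ev k).state i

/-- The channel from `i` to `j` before event `k`. -/
abbrev ch (prog : Fin n → ℕ → In → Prog F Out) (ev : ℕ → Event n In) (k : ℕ) (i j : Fin n) :
    List (ℕ × XMsg F) :=
  ((xchProtocol prog).configAt ev k).chan i j

/-- The node `i` does not start or finish an exchange in event `k`. -/
structure Quiet (prog : Fin n → ℕ → In → Prog F Out) (ev : ℕ → Event n In) (k : ℕ) (i : Fin n) :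
    Prop where
  tag : (st prog ev (k + 1) i).tag = (st prog ev k i).tag
  kst : (st prog ev (k + 1) i).kst = (st prog ev k i).kst
  cnt : (st prog ev (k + 1) i).cnt = (st prog ev k i).cnt
  cont : (st prog ev (k + 1) i).cont = (st prog ev k i).cont
  know : (st prog ev k i).know ⊆ (st prog ev (k + 1) i).know
  know_le : ∀ φ ∈ (st prog ev (k + 1) i).know, φ ∈ (st prog ev k i).know ∨
    ∃ j t m, (t, m) ∈ ch prog ev k j i ∧ φ ∈ m.know
  acks : (st prog ev (k + 1) i).acks = (st prog ev k i).acks ∨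
    2 * (st prog ev (k + 1) i).acks.card ≤ n
  acks_sub : (st prog ev k i).acks ⊆ (st prog ev (k + 1) i).acks
  acks_le : ∀ j ∈ (st prog ev (k + 1) i).acks, j ∈ (st prog ev k i).acks ∨
    ∃ t m, (t, m) ∈ ch prog ev k j i ∧ m.isReq = false ∧ m.tag = (st prog ev k i).tag ∧
      m.know ⊆ (st prog ev (k + 1) i).know
  no_return : ∀ o, ¬ (xchProtocol prog).Returns ev k i o
  acks_receive : ∀ j t m cut rest, ev k = .deliver j i cut → ch prog ev k j i = (t, m) :: rest →
    m.isReq = false → m.tag = (st prog ev k i).tag → (st prog ev k i).cont ≠ none →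
      j ∈ (st prog ev (k + 1) i).acks

/-- In event `k`, node `i` runs the program `p` from state `s`. -/
structure Runs (prog : Fin n → ℕ → In → Prog F Out) (ev : ℕ → Event n In) (k : ℕ) (i : Fin n)
    (s : XState n F Out) (p : Prog F Out) : Prop where
  handles : ∃ cut, Handles (xchProtocol prog) ev k i (s.run p) cut
  tag : s.tag = (st prog ev k i).tag
  know : (st prog ev k i).know ⊆ s.know

/-- Covers the receptions that only add knowledge, or that add an acknowledgement without reaching a
majority. -/
theorem quiet_of_handles {k : ℕ} {i j : Fin n} {cut : Option ℕ} {t : ℕ} {m : XMsg F}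
    {rest : List (ℕ × XMsg F)} {R : Reaction n (XState n F Out) (XMsg F) Out}
    (he : ev k = .deliver j i cut) (hc : ch prog ev k j i = (t, m) :: rest)
    (h : Handles (xchProtocol prog) ev k i R cut)
    (hR : R.response = none)
    (hs : R.state = (st prog ev k i).absorb m ∧ (m.isReq = true ∨ (st prog ev k i).cont = none ∨
        m.tag ≠ (st prog ev k i).tag) ∨
      (m.isReq = false ∧ m.tag = (st prog ev k i).tag ∧
        2 * (insert j (st prog ev k i).acks).card ≤ n ∧
        R.state = { (st prog ev k i).absorb m with acks := insert j (st prog ev k i).acks })) :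
    Quiet prog ev k i := by
  have hst : st prog ev (k + 1) i = R.state := state_of_handles h
  have hmem : (t, m) ∈ ch prog ev k j i := by rw [hc]; exact List.mem_cons_self
  have hret : ∀ o, ¬ (xchProtocol prog).Returns ev k i o := by
    intro o ho
    obtain ⟨R', h1, h2⟩ := ho.handles
    obtain ⟨-, rfl, -⟩ := handles_unique h h1
    rw [hR] at h2; cases h2
  rcases hs with ⟨hs, hcase⟩ | ⟨h1, h2, h3, hs⟩
  · rw [hs] at hst
    constructor <;> try simp only [hst, XState.absorb]
    · exact Set.subset_union_left
    · rintro φ (hφ | hφ)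
      · exact .inl hφ
      · exact .inr ⟨j, t, m, hmem, hφ⟩
    · exact .inl trivial
    · exact subset_rfl
    · exact fun l hl => .inl hl
    · exact hret
    · intro j' t' m' cut' rest' he' hc' h1 h2 h3
      rw [he] at he'; cases he'
      rw [hc] at hc'; cases hc'
      rcases hcase with h | h | h
      · rw [h1] at h; cases h
      · exact absurd h h3
      · exact absurd h2 h
  · rw [hs] at hst
    constructor <;> try simp only [hst, XState.absorb]
    · exact Set.subset_union_left
    · rintro φ (hφ | hφ)
      · exact .inl hφ
      · exact .inr ⟨j, t, m, hmem, hφ⟩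
    · exact .inr h3
    · exact Finset.subset_insert _ _
    · intro l hl
      rcases Finset.mem_insert.1 hl with rfl | hl
      · exact .inr ⟨t, m, hmem, h1, h2, Set.subset_union_right⟩
      · exact .inl hl
    · exact hret
    · intro j' t' m' cut' rest' he' hc' h1 h2 h3
      rw [he] at he'; cases he'
      exact Finset.mem_insert_self _ _

theorem quiet_of_not_handles {k : ℕ} {i : Fin n}
    (hst : st prog ev (k + 1) i = st prog ev k i)
    (h : ∀ R cut, ¬ Handles (xchProtocol prog) ev k i R cut) : Quiet prog ev k i := by
  constructor <;> try simp only [hst]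
  · exact subset_rfl
  · exact fun φ hφ => .inl hφ
  · exact .inl trivial
  · exact subset_rfl
  · exact fun j hj => .inl hj
  · intro o ho
    obtain ⟨R', h1, h2⟩ := ho.handles
    exact h _ _ h1
  · intro j t m cut rest he hc _ _ _
    exact absurd (Handles.deliver j cut t m rest he hc) (h _ _)

/-- The case distinction behind the inductions over events: nothing essential happens, an operation
starts, or a reply completes the majority and the continuation runs. -/
theorem node_step (k : ℕ) (i : Fin n) :
    Quiet prog ev k i ∨
    (∃ x, Invokes ev k i x ∧ Runs prog ev k i { st prog ev k i with cnt := (st prog ev k i).cnt + 1 }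
      (prog i (st prog ev k i).cnt x)) ∨
    (∃ j t m c, (t, m) ∈ ch prog ev k j i ∧ m.isReq = false ∧ m.tag = (st prog ev k i).tag ∧
      (st prog ev k i).cont = some c ∧ n < 2 * (insert j (st prog ev k i).acks).card ∧
      Runs prog ev k i ((st prog ev k i).absorb m) (c ((st prog ev k i).know ∪ m.know))) := by
  by_cases hh : ∃ R cut, Handles (xchProtocol prog) ev k i R cut
  swap
  · push Not at hh
    left
    rcases state_succ (P := xchProtocol prog) (ev := ev) k i with h | ⟨R, cut, h⟩
    · exact quiet_of_not_handles h hh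
    · exact absurd h (hh R cut)
  obtain ⟨R, cut, h⟩ := hh
  cases h with
  | invoke x cut h =>
    right; left
    exact ⟨x, ⟨cut, h⟩, ⟨⟨cut, .invoke x cut h⟩, rfl, subset_rfl⟩⟩
  | deliver j cut t m rest h hc =>
    have hH := Handles.deliver (P := xchProtocol prog) j cut t m rest h hc
    have hmem : (t, m) ∈ ch prog ev k j i := by
      show (t, m) ∈ ((xchProtocol prog).configAt ev k).chan j i
      rw [hc]; exact List.mem_cons_self
    change Handles (xchProtocol prog) ev k i ((st prog ev k i).receive j m) cut at hH
    unfold XState.receive at hH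
    by_cases hreq : m.isReq = true
    · rw [if_pos hreq] at hH
      exact .inl (quiet_of_handles h hc hH rfl (.inl ⟨rfl, .inl hreq⟩))
    · rw [if_neg hreq] at hH
      rcases hcont : (st prog ev k i).cont with _ | c
      · simp only [hcont] at hH
        exact .inl (quiet_of_handles h hc hH rfl (.inl ⟨rfl, .inr (.inl hcont)⟩))
      · simp only [hcont] at hH
        by_cases htag : m.tag = (st prog ev k i).tag
        · rw [if_pos htag] at hH
          by_cases hmaj : n < 2 * (insert j (st prog ev k i).acks).card
          · rw [if_pos hmaj] at hH
            right; right
            exact ⟨j, t, m, c, hmem, by simpa using hreq, htag, rfl, hmaj,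
              ⟨⟨cut, hH⟩, rfl, Set.subset_union_left⟩⟩
          · rw [if_neg hmaj] at hH
            exact .inl (quiet_of_handles h hc hH rfl
              (.inr ⟨by simpa using hreq, htag, not_lt.1 hmaj, rfl⟩))
        · rw [if_neg htag] at hH
          exact .inl (quiet_of_handles h hc hH rfl (.inl ⟨rfl, .inr (.inr htag)⟩))

theorem Runs.state {k : ℕ} {i : Fin n} {s : XState n F Out} {p : Prog F Out}
    (h : Runs prog ev k i s p) : st prog ev (k + 1) i = (s.run p).state :=
  state_of_handles h.handles.choose_spec

theorem Runs.returns {k : ℕ} {i : Fin n} {s : XState n F Out} {p : Prog F Out} {o : Out}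
    (h : Runs prog ev k i s p) (ho : (xchProtocol prog).Returns ev k i o) :
    (s.run p).response = some o := by
  obtain ⟨cut, hc⟩ := h.handles
  obtain ⟨R, h1, h2⟩ := ho.handles
  obtain ⟨-, rfl, -⟩ := handles_unique hc h1
  exact h2

theorem subset_run (s : XState n F Out) (p : Prog F Out) : s.know ⊆ (s.run p).state.know := by
  cases p <;> exact Set.subset_union_left

theorem know_mono (i : Fin n) : Monotone fun k => (st prog ev k i).know := by
  refine monotone_nat_of_le_succ fun k => ?_
  rcases node_step (prog := prog) (ev := ev) k i with h | ⟨x, -, h⟩ | ⟨j, t, m, c, -, -, -, -, -, h⟩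
  · exact h.know
  · rw [h.state]; exact h.know.trans (subset_run _ _)
  · rw [h.state]; exact h.know.trans (subset_run _ _)

/-- A message that is not in transit before event `k` but afterwards is a request of a new exchange
or a reply to a request. -/
theorem msg_new {k : ℕ} {i j : Fin n} {t : ℕ} {m : XMsg F} (h : (t, m) ∈ ch prog ev (k + 1) i j) :
    (t, m) ∈ ch prog ev k i j ∨
    (m.isReq = true ∧ m.tag = (st prog ev (k + 1) i).tag ∧ m.know = (st prog ev (k + 1) i).kst ∧
      m.know = (st prog ev (k + 1) i).know) ∨
    (m.isReq = false ∧ m.know = (st prog ev (k + 1) i).know ∧ ∃ t' m', (t', m') ∈ ch prog ev k j i ∧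
      m'.isReq = true ∧ m.tag = m'.tag ∧ m'.know ⊆ m.know) := by
  have hrun : ∀ (s : XState n F Out) (p : Prog F Out), (j, m) ∈ (s.run p).sends →
      m.isReq = true ∧ m.tag = (s.run p).state.tag ∧ m.know = (s.run p).state.kst ∧
        m.know = (s.run p).state.know := by
    intro s p hm
    cases p with
    | ret add o => simp [XState.run] at hm
    | xch add c =>
      simp only [XState.run, List.mem_map, List.mem_finRange, true_and, Prod.mk.injEq] at hm
      obtain ⟨_, rfl, rfl⟩ := hm
      exact ⟨rfl, rfl, rfl, rfl⟩
  rcases mem_chan_succ h with h | ⟨rfl, R, cut, hR, hm⟩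
  · exact .inl h
  right
  have hst : st prog ev (t + 1) i = R.state := state_of_handles hR
  rw [hst]
  cases hR with
  | invoke x cut h => exact .inl (hrun _ _ hm)
  | deliver l cut t' m' rest h hc =>
    change (j, m) ∈ ((st prog ev t i).receive l m').sends at hm
    show _ ∨ (m.isReq = false ∧ m.know = ((st prog ev t i).receive l m').state.know ∧ _)
    change (m.isReq = true ∧ m.tag = ((st prog ev t i).receive l m').state.tag ∧
      m.know = ((st prog ev t i).receive l m').state.kst ∧
      m.know = ((st prog ev t i).receive l m').state.know) ∨ _
    unfold XState.receive at hm ⊢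
    by_cases hreq : m'.isReq = true
    · rw [if_pos hreq] at hm ⊢
      simp only [List.mem_singleton, Prod.mk.injEq] at hm
      obtain ⟨rfl, rfl⟩ := hm
      right
      refine ⟨rfl, rfl, t', m', ?_, hreq, rfl, Set.subset_union_right⟩
      show (t', m') ∈ ((xchProtocol prog).configAt ev t).chan j i
      rw [hc]; exact List.mem_cons_self
    · rw [if_neg hreq] at hm ⊢
      rcases hcont : (st prog ev t i).cont with _ | c
      · simp [hcont] at hm
      · simp only [hcont] at hm ⊢
        by_cases htag : m'.tag = (st prog ev t i).tag
        · rw [if_pos htag] at hm ⊢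
          by_cases hmaj : n < 2 * (insert l (st prog ev t i).acks).card
          · rw [if_pos hmaj] at hm ⊢
            exact .inl (hrun _ _ hm)
          · rw [if_neg hmaj] at hm; simp at hm
        · rw [if_neg htag] at hm; simp at hm

/-- A message carries all that its sender knows on sending it, and knowledge is never lost. -/
theorem msg_know {k : ℕ} {i j : Fin n} {t : ℕ} {m : XMsg F} (h : (t, m) ∈ ch prog ev k i j) :
    m.know ⊆ (st prog ev k i).know := by
  induction k with
  | zero => simp [ch, configAt, initConfig] at h
  | succ k ih =>
    rcases msg_new h with h | ⟨-, -, -, h⟩ | ⟨-, h, -⟩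
    · exact (ih h).trans (know_mono i (Nat.le_succ k))
    · exact h.le
    · exact h.le

theorem tag_le_succ (k : ℕ) (i : Fin n) : (st prog ev k i).tag ≤ (st prog ev (k + 1) i).tag := by
  have hrun : ∀ (s : XState n F Out) (p : Prog F Out), s.tag ≤ (s.run p).state.tag := by
    intro s p
    cases p with
    | ret add o => exact le_rfl
    | xch add c => exact Nat.le_succ _
  rcases node_step (prog := prog) (ev := ev) k i with h | ⟨x, -, h⟩ | ⟨j, t, m, c, -, -, -, -, -, h⟩
  · exact h.tag.ge
  · rw [h.state, ← h.tag]; exact hrun _ _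
  · rw [h.state, ← h.tag]; exact hrun _ _

/-- Guarantees that the tag of a new exchange is fresh: no message in transit carries it, so stale
replies are never counted. -/
theorem msg_tag (k : ℕ) (i j : Fin n) {t : ℕ} {m : XMsg F} (h : (t, m) ∈ ch prog ev k i j) :
    (m.isReq = true → m.tag ≤ (st prog ev k i).tag) ∧
      (m.isReq = false → m.tag ≤ (st prog ev k j).tag) := by
  induction k generalizing i j t m with
  | zero => simp [ch, configAt, initConfig] at h
  | succ k ih =>
    rcases msg_new h with h | ⟨h1, h2, -⟩ | ⟨h1, -, t', m', h2, h3, h4, -⟩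
    · exact ⟨fun h' => ((ih i j h).1 h').trans (tag_le_succ k i),
        fun h' => ((ih i j h).2 h').trans (tag_le_succ k j)⟩
    · exact ⟨fun _ => h2.le, fun h' => absurd (h1.symm.trans h') (by decide)⟩
    · refine ⟨fun h' => absurd (h1.symm.trans h') (by decide), fun _ => ?_⟩
      rw [h4]
      exact ((ih j i h2).1 h3).trans (tag_le_succ k j)

/-- A continuation is stored exactly when running a program gives no response, so the client stays
busy. The second alternative is needed since crashed nodes keep their state. -/
theorem busy_of_cont {k : ℕ} {i : Fin n} (h : (st prog ev k i).cont ≠ none) :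
    i ∈ ((xchProtocol prog).configAt ev k).busy ∨
      i ∈ ((xchProtocol prog).configAt ev k).crashed := by
  have hrun : ∀ (s : XState n F Out) (p : Prog F Out), (s.run p).state.cont ≠ none →
      (s.run p).response = none := by
    intro s p hp
    cases p with
    | ret add o => exact absurd rfl hp
    | xch add c => rfl
  induction k with
  | zero => exact absurd rfl h
  | succ k ih =>
    rcases node_step (prog := prog) (ev := ev) k i with hq | ⟨x, hx, hr⟩ |
      ⟨j, t, m, c, -, -, -, hc, -, hr⟩
    · rw [hq.cont] at h
      rcases ih h with h | h
      · rcases busy_succ h with h | ⟨o, h⟩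
        · exact .inl h
        · exact absurd h (hq.no_return o)
      · exact .inr (crashed_succ k h)
    · rw [hr.state] at h
      rcases busy_of_invokes (P := xchProtocol prog) hx with h' | ⟨o, h'⟩
      · exact .inl h'
      · have := hr.returns h'
        rw [hrun _ _ h] at this; cases this
    · rw [hr.state] at h
      rcases ih (by rw [hc]; exact Option.some_ne_none c) with h' | h'
      · rcases busy_succ h' with h' | ⟨o, h'⟩
        · exact .inl h'
        · have := hr.returns h'
          rw [hrun _ _ h] at this; cases this
      · exact .inr (crashed_succ k h')

theorem cont_eq_none_of_invokes (hex : (xchProtocol prog).IsExecution f ev) {k : ℕ} {i : Fin n}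
    {x : In} (h : Invokes ev k i x) : (st prog ev k i).cont = none := by
  by_contra hcon
  obtain ⟨cut, h⟩ := h
  have := (hex k).1
  rw [h] at this
  rcases busy_of_cont hcon with h' | h'
  · exact this.2 h'
  · exact this.1 h'

end XProtocol

/-! ### The invariant of executions and soundness of weakest preconditions. -/

namespace XProtocol

open Protocol

variable {n : ℕ} {F In Out : Type u} {prog : Fin n → ℕ → In → Prog F Out} {f : ℕ}
  {ev : ℕ → Event n In} {S : Assertions n F In Out}

/-- The knowledge of the nodes in an execution. -/
def knowAt (prog : Fin n → ℕ → In → Prog F Out) (ev : ℕ → Event n In) (k : ℕ) (i : Fin n) : Set F :=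
  (st prog ev k i).know

/-- The exchange of node `i` that is in progress before event `k` started at time `s`, and belongs
to the operation `x` invoked in event `a`. -/
structure Pending (prog : Fin n → ℕ → In → Prog F Out) (ev : ℕ → Event n In)
    (S : Assertions n F In Out) (k : ℕ) (i : Fin n) (c : Set F → Prog F Out) (s a : ℕ) (x : In) :
    Prop where
  start_le : s ≤ k
  inv_lt : a < s
  inv : Invokes ev a i x
  no_return : ∀ b, a ≤ b → b < k → ∀ o, ¬ (xchProtocol prog).Returns ev b i o
  req : ∀ j t m, (t, m) ∈ ch prog ev k i j → m.isReq = true → m.tag = (st prog ev k i).tag →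
    (st prog ev k i).kst ⊆ m.know
  rep : ∀ j t m, (t, m) ∈ ch prog ev k j i → m.isReq = false → m.tag = (st prog ev k i).tag →
    ∃ h, s ≤ h ∧ h ≤ k ∧ (st prog ev k i).kst ⊆ knowAt prog ev h j ∧ knowAt prog ev h j ⊆ m.know
  ack : ∀ j ∈ (st prog ev k i).acks, ∃ h, s ≤ h ∧ h ≤ k ∧
    (st prog ev k i).kst ⊆ knowAt prog ev h j ∧ knowAt prog ev h j ⊆ knowAt prog ev k i
  own : ∀ φ ∈ knowAt prog ev k i, S.own φ i → φ ∈ (st prog ev k i).kst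
  wp : ∀ e Ke, s ≤ e → Exchange (knowAt prog ev) s e (st prog ev k i).kst Ke →
    knowAt prog ev e i ⊆ Ke → Ke ⊆ knowAt prog ev (e + 1) i → (∀ φ ∈ Ke, S.OK e φ) →
    (∀ φ ∈ Ke, S.own φ i → φ ∈ (st prog ev k i).kst) → S.wp i a x (c Ke) e Ke

/-- The invariant of executions. -/
structure Inv (prog : Fin n → ℕ → In → Prog F Out) (ev : ℕ → Event n In)
    (S : Assertions n F In Out) (k : ℕ) : Prop where
  ok : ∀ i, ∀ φ ∈ knowAt prog ev k i, S.OK k φ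
  own : ∀ i j φ, S.own φ j → φ ∈ knowAt prog ev k i → φ ∈ knowAt prog ev k j
  idle : ∀ i, (st prog ev k i).cont = none → S.Idle i (knowAt prog ev k i)
  pend : ∀ i c, (st prog ev k i).cont = some c → ∃ s a x, Pending prog ev S k i c s a x

/-- A request with the current tag carries the starting knowledge, and a node absorbs it before
replying with all that it knows. Such a reply therefore witnesses a moment of the kind that
`Exchange` demands. -/
theorem Pending.quiet {k : ℕ} {i : Fin n} {c : Set F → Prog F Out} {s a : ℕ} {x : In}
    (h : Pending prog ev S k i c s a x) (hI : Inv prog ev S k) (hq : Quiet prog ev k i) :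
    Pending prog ev S (k + 1) i c s a x where
  start_le := h.start_le.trans (Nat.le_succ k)
  inv_lt := h.inv_lt
  inv := h.inv
  no_return b h1 h2 := by
    rcases Nat.lt_succ_iff_lt_or_eq.1 h2 with h2 | rfl
    · exact h.no_return b h1 h2
    · exact hq.no_return
  req j t m hm h1 h2 := by
    rw [hq.kst]
    rw [hq.tag] at h2
    rcases msg_new hm with hm | ⟨-, -, hm, -⟩ | ⟨hm, -⟩
    · exact h.req j t m hm h1 h2
    · rw [hm, hq.kst]
    · rw [h1] at hm; cases hm
  rep j t m hm h1 h2 := by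
    rw [hq.kst]
    rw [hq.tag] at h2
    rcases msg_new hm with hm | ⟨hm, -⟩ | ⟨-, h3, t', m', h4, h5, h6, h7⟩
    · obtain ⟨l, hl1, hl2, hl3⟩ := h.rep j t m hm h1 h2
      exact ⟨l, hl1, hl2.trans (Nat.le_succ k), hl3⟩
    · rw [h1] at hm; cases hm
    · refine ⟨k + 1, h.start_le.trans (Nat.le_succ k), le_rfl, ?_, h3.ge⟩
      have := h.req j t' m' h4 h5 (h6.symm.trans h2)
      exact (this.trans h7).trans h3.le
  ack j hj := by
    rw [hq.kst]
    rcases hq.acks_le j hj with hj | ⟨t, m, h1, h2, h3, h4⟩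
    · obtain ⟨l, hl1, hl2, hl3, hl4⟩ := h.ack j hj
      exact ⟨l, hl1, hl2.trans (Nat.le_succ k), hl3, hl4.trans hq.know⟩
    · obtain ⟨l, hl1, hl2, hl3, hl4⟩ := h.rep j t m h1 h2 h3
      exact ⟨l, hl1, hl2.trans (Nat.le_succ k), hl3, hl4.trans h4⟩
  own φ hφ ho := by
    rw [hq.kst]
    rcases hq.know_le φ hφ with hφ | ⟨j, t, m, hm, hφ⟩
    · exact h.own φ hφ ho
    · exact h.own φ (hI.own j i φ ho (msg_know hm hφ)) ho
  wp e Ke := by rw [hq.kst]; exact h.wp e Ke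

/-- What running a program does to the invariant. -/
theorem run_step (hKn : S.Kn = knowAt prog ev) (hmono : ∀ k φ, S.OK k φ → S.OK (k + 1) φ)
    {k : ℕ} {i : Fin n} {s : XState n F Out} {p : Prog F Out} {a : ℕ} {x : In}
    (hr : Runs prog ev k i s p) (hok : ∀ φ ∈ s.know, S.OK k φ)
    (hown : ∀ φ ∈ s.know, ∀ j, S.own φ j → φ ∈ knowAt prog ev k j)
    (hinv : Invokes ev a i x) (hak : a ≤ k)
    (hret : ∀ b, a ≤ b → b < k → ∀ o, ¬ (xchProtocol prog).Returns ev b i o)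
    (hwp : S.wp i a x p k s.know) :
    (∀ φ ∈ knowAt prog ev (k + 1) i, S.OK (k + 1) φ) ∧
    (∀ j φ, S.own φ j → φ ∈ knowAt prog ev (k + 1) i → φ ∈ knowAt prog ev (k + 1) j) ∧
    ((st prog ev (k + 1) i).cont = none → S.Idle i (knowAt prog ev (k + 1) i)) ∧
    (∀ c, (st prog ev (k + 1) i).cont = some c →
      ∃ s a x, Pending prog ev S (k + 1) i c s a x) ∧
    ∀ o, (xchProtocol prog).Returns ev k i o →
      (xchProtocol prog).Completes ev a i x k o ∧ S.Post i a x k o := by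
  have hst := hr.state
  have hold : ∀ add : Set F, knowAt prog ev (k + 1) i = s.know ∪ add →
      (∀ φ ∈ add, S.OK (k + 1) φ ∧ ∀ p, S.own φ p → p = i) →
      (∀ φ ∈ knowAt prog ev (k + 1) i, S.OK (k + 1) φ) ∧
      (∀ j φ, S.own φ j → φ ∈ knowAt prog ev (k + 1) i → φ ∈ knowAt prog ev (k + 1) j) := by
    intro add hK hadd
    constructor
    · intro φ hφ
      rw [hK] at hφ
      rcases hφ with hφ | hφ
      · exact hmono _ _ (hok φ hφ)
      · exact (hadd φ hφ).1
    · intro j φ ho hφ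
      rcases (hK ▸ hφ : φ ∈ s.know ∪ add) with hφ' | hφ'
      · exact know_mono j (Nat.le_succ k) (hown φ hφ' j ho)
      · rwa [(hadd φ hφ').2 j ho]
  cases p with
  | ret add o =>
    have hK : knowAt prog ev (k + 1) i = s.know ∪ add := by rw [knowAt, hst]; rfl
    obtain ⟨hadd, hidle, hpost⟩ := hwp (by rw [hKn]; exact hK)
    refine ⟨(hold add hK hadd).1, (hold add hK hadd).2, fun _ => by rwa [hK], ?_, ?_⟩
    · intro c hc; rw [hst] at hc; cases hc
    · intro o' ho'
      have := hr.returns ho'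
      cases this
      exact ⟨⟨hinv, hak, ho', hret⟩, hpost⟩
  | xch add c =>
    have hK : knowAt prog ev (k + 1) i = s.know ∪ add := by rw [knowAt, hst]; rfl
    have hkst : (st prog ev (k + 1) i).kst = s.know ∪ add := by rw [hst]; rfl
    have htag : (st prog ev (k + 1) i).tag = (st prog ev k i).tag + 1 := by
      rw [hst, ← hr.tag]; rfl
    have hacks : (st prog ev (k + 1) i).acks = ∅ := by rw [hst]; rfl
    have hnoret : ∀ o, ¬ (xchProtocol prog).Returns ev k i o := by
      intro o ho
      have := hr.returns ho
      cases this
    obtain ⟨hadd, hcont⟩ := hwp (by rw [hKn]; exact hK)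
    refine ⟨(hold add hK hadd).1, (hold add hK hadd).2, ?_, ?_, fun o ho => absurd ho (hnoret o)⟩
    · intro hc; rw [hst] at hc; cases hc
    · intro c' hc'
      have hcc : c = c' := by rw [hst] at hc'; exact Option.some.inj hc'
      subst hcc
      -- The new tag exceeds all tags in transit, so only the requests just sent carry it and there
      -- are no replies to them yet.
      refine ⟨k + 1, a, x, le_rfl, Nat.lt_succ_of_le hak, hinv, ?_, ?_, ?_, ?_, ?_, ?_⟩
      · intro b h1 h2
        rcases Nat.lt_succ_iff_lt_or_eq.1 h2 with h2 | rfl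
        · exact hret b h1 h2
        · exact hnoret
      · intro j t m hm h1 h2
        rcases msg_new hm with hm | ⟨-, -, hm, -⟩ | ⟨hm, -⟩
        · have := (msg_tag k i j hm).1 h1
          omega
        · exact hm.ge
        · rw [h1] at hm; cases hm
      · intro j t m hm h1 h2
        rcases msg_new hm with hm | ⟨hm, -⟩ | ⟨-, -, t', m', h4, h5, h6, -⟩
        · have := (msg_tag k j i hm).2 h1
          omega
        · rw [h1] at hm; cases hm
        · have := (msg_tag k i j h4).1 h5
          omega
      · intro j hj; rw [hacks] at hj; simp at hj
      · intro φ hφ _; rwa [hkst, ← hK]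
      · intro e Ke he hE h1 h2 h3 h4
        rw [hkst] at hE h4
        rw [← hKn] at hE h1 h2
        exact hcont e Ke he hE h1 h2 h3 h4

theorem inv_step (hex : (xchProtocol prog).IsExecution f ev) (hKn : S.Kn = knowAt prog ev)
    (hmono : ∀ k φ, S.OK k φ → S.OK (k + 1) φ)
    (hidle : ∀ i K K', S.Idle i K → K ⊆ K' → (∀ φ ∈ K', S.own φ i → φ ∈ K) → S.Idle i K')
    (hop : ∀ i a x, Invokes ev a i x → S.Idle i (knowAt prog ev a i) →
      (∀ q, ∀ φ ∈ knowAt prog ev a q, S.OK a φ) →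
      S.wp i a x (prog i (st prog ev a i).cnt x) a (knowAt prog ev a i))
    {k : ℕ} (hI : Inv prog ev S k) :
    Inv prog ev S (k + 1) ∧ ∀ i o, (xchProtocol prog).Returns ev k i o →
      ∃ a x, (xchProtocol prog).Completes ev a i x k o ∧ S.Post i a x k o := by
  have key : ∀ i,
      (∀ φ ∈ knowAt prog ev (k + 1) i, S.OK (k + 1) φ) ∧
      (∀ j φ, S.own φ j → φ ∈ knowAt prog ev (k + 1) i → φ ∈ knowAt prog ev (k + 1) j) ∧
      ((st prog ev (k + 1) i).cont = none → S.Idle i (knowAt prog ev (k + 1) i)) ∧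
      (∀ c, (st prog ev (k + 1) i).cont = some c →
        ∃ s a x, Pending prog ev S (k + 1) i c s a x) ∧
      ∀ o, (xchProtocol prog).Returns ev k i o →
        ∃ a x, (xchProtocol prog).Completes ev a i x k o ∧ S.Post i a x k o := by
    intro i
    rcases node_step (prog := prog) (ev := ev) k i with hq | ⟨x, hx, hr⟩ |
      ⟨j, t, m, c, hm, hreq, htag, hc, hmaj, hr⟩
    · have hfrom : ∀ φ ∈ knowAt prog ev (k + 1) i, ∃ j, φ ∈ knowAt prog ev k j := by
        intro φ hφ
        rcases hq.know_le φ hφ with hφ | ⟨j, t, m, hm, hφ⟩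
        · exact ⟨i, hφ⟩
        · exact ⟨j, msg_know hm hφ⟩
      have hown : ∀ j φ, S.own φ j → φ ∈ knowAt prog ev (k + 1) i → φ ∈ knowAt prog ev k j := by
        intro j φ ho hφ
        obtain ⟨l, hl⟩ := hfrom φ hφ
        exact hI.own l j φ ho hl
      refine ⟨?_, ?_, ?_, ?_, fun o ho => absurd ho (hq.no_return o)⟩
      · intro φ hφ
        obtain ⟨l, hl⟩ := hfrom φ hφ
        exact hmono _ _ (hI.ok l φ hl)
      · intro j φ ho hφ
        exact know_mono j (Nat.le_succ k) (hown j φ ho hφ)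
      · intro hc
        rw [hq.cont] at hc
        exact hidle i _ _ (hI.idle i hc) hq.know fun φ hφ ho => hown i φ ho hφ
      · intro c hc
        rw [hq.cont] at hc
        obtain ⟨s, a, x, hp⟩ := hI.pend i c hc
        exact ⟨s, a, x, hp.quiet hI hq⟩
    · have hnone := cont_eq_none_of_invokes hex hx
      obtain ⟨h1, h2, h3, h4, h5⟩ := run_step hKn hmono hr (hI.ok i)
        (fun φ hφ j ho => hI.own i j φ ho hφ) hx le_rfl (fun b hb hb' => by omega)
        (hop i k x hx (hI.idle i hnone) hI.ok)
      exact ⟨h1, h2, h3, h4, fun o ho => ⟨k, x, h5 o ho⟩⟩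
    · obtain ⟨s, a, x, hp⟩ := hI.pend i c hc
      have hok : ∀ φ ∈ ((st prog ev k i).absorb m).know, S.OK k φ := by
        rintro φ (hφ | hφ)
        · exact hI.ok i φ hφ
        · exact hI.ok j φ (msg_know hm hφ)
      have hown : ∀ φ ∈ ((st prog ev k i).absorb m).know, ∀ l, S.own φ l →
          φ ∈ knowAt prog ev k l := by
        rintro φ (hφ | hφ) l ho
        · exact hI.own i l φ ho hφ
        · exact hI.own j l φ ho (msg_know hm hφ)
      -- The nodes acknowledged so far, together with the sender of this last reply, are the
      -- majority.
      have hE : Exchange (knowAt prog ev) s k (st prog ev k i).kst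
          ((st prog ev k i).know ∪ m.know) := by
        refine ⟨_, hmaj, fun l hl => ?_⟩
        rcases Finset.mem_insert.1 hl with rfl | hl
        · obtain ⟨h, h1, h2, h3, h4⟩ := hp.rep l t m hm hreq htag
          exact ⟨h, h1, h2, h3, h4.trans Set.subset_union_right⟩
        · obtain ⟨h, h1, h2, h3, h4⟩ := hp.ack l hl
          exact ⟨h, h1, h2, h3, h4.trans Set.subset_union_left⟩
      have hsub : (st prog ev k i).know ∪ m.know ⊆ knowAt prog ev (k + 1) i := by
        have := subset_run ((st prog ev k i).absorb m) (c ((st prog ev k i).know ∪ m.know))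
        rw [knowAt, hr.state]
        exact this
      have hwp := hp.wp k _ hp.start_le hE Set.subset_union_left hsub hok
        (fun φ hφ ho => hp.own φ (hown φ hφ i ho) ho)
      obtain ⟨h1, h2, h3, h4, h5⟩ := run_step hKn hmono hr hok hown hp.inv
        (hp.inv_lt.le.trans hp.start_le) hp.no_return hwp
      exact ⟨h1, h2, h3, h4, fun o ho => ⟨a, x, h5 o ho⟩⟩
  exact ⟨⟨fun i => (key i).1, fun i j φ => (key i).2.1 j φ, fun i => (key i).2.2.1,
    fun i c => (key i).2.2.2.1 c⟩, fun i => (key i).2.2.2.2⟩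

/-- If every operation satisfies its weakest precondition when it is invoked, then all facts are
correct, and all responses satisfy the postcondition. -/
theorem sound (hex : (xchProtocol prog).IsExecution f ev) (hKn : S.Kn = knowAt prog ev)
    (hmono : ∀ k φ, S.OK k φ → S.OK (k + 1) φ)
    (hidle₀ : ∀ i, S.Idle i ∅)
    (hidle : ∀ i K K', S.Idle i K → K ⊆ K' → (∀ φ ∈ K', S.own φ i → φ ∈ K) → S.Idle i K')
    (hop : ∀ i a x, Invokes ev a i x → S.Idle i (knowAt prog ev a i) →
      (∀ q, ∀ φ ∈ knowAt prog ev a q, S.OK a φ) →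
      S.wp i a x (prog i (st prog ev a i).cnt x) a (knowAt prog ev a i)) :
    (∀ k i, ∀ φ ∈ knowAt prog ev k i, S.OK k φ) ∧
    ∀ b i o, (xchProtocol prog).Returns ev b i o →
      ∃ a x, (xchProtocol prog).Completes ev a i x b o ∧ S.Post i a x b o := by
  have hall : ∀ k, Inv prog ev S k := by
    intro k
    induction k with
    | zero =>
      exact ⟨fun i φ hφ => absurd hφ (Set.notMem_empty φ),
        fun i j φ _ hφ => absurd hφ (Set.notMem_empty φ), fun i _ => hidle₀ i, fun i c hc => by cases hc⟩
    | succ k ih => exact (inv_step hex hKn hmono hidle hop ih).1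
  exact ⟨fun k => (hall k).ok, fun b i o => (inv_step hex hKn hmono hidle hop (hall b)).2 i o⟩

/-! ### Running time -/

/-- The program makes at most `m` exchanges. -/
inductive DepthLE : ℕ → Prog F Out → Prop
  | ret (m : ℕ) (add : Set F) (o : Out) : DepthLE m (.ret add o)
  | xch (m : ℕ) (add : Set F) (c : Set F → Prog F Out) (h : ∀ K, DepthLE m (c K)) :
    DepthLE (m + 1) (.xch add c)

theorem DepthLE.mono {m m' : ℕ} {p : Prog F Out} (h : DepthLE m p) (hm : m ≤ m') :
    DepthLE m' p := by
  induction h generalizing m' with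
  | ret m add o => exact .ret m' add o
  | xch m add c h ih =>
    obtain ⟨l, rfl⟩ := Nat.exists_eq_add_of_le' (Nat.le_of_succ_le hm)
    obtain ⟨l', hl'⟩ : ∃ l', l + m = l' + 1 := ⟨l + m - 1, by omega⟩
    rw [hl']
    exact .xch l' add c fun K => ih K (by omega)

/-- The reply that would complete a majority ends the exchange instead of being recorded. -/
theorem card_acks (k : ℕ) (i : Fin n) : 2 * (st prog ev k i).acks.card ≤ n := by
  have hrun : ∀ (s : XState n F Out) (p : Prog F Out), 2 * s.acks.card ≤ n →
      2 * (s.run p).state.acks.card ≤ n := by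
    intro s p hs
    cases p with
    | ret add o => exact hs
    | xch add c => simp [XState.run]
  induction k with
  | zero => simp [st, configAt, initConfig]
  | succ k ih =>
    rcases node_step (prog := prog) (ev := ev) k i with hq | ⟨x, -, hr⟩ |
      ⟨j, t, m, c, -, -, -, -, -, hr⟩
    · rcases hq.acks with h | h
      · rwa [h]
      · exact h
    · rw [hr.state]; exact hrun _ _ ih
    · rw [hr.state]; exact hrun _ _ ih

end XProtocol

/-! ### The nonfaulty majority and the duration of exchanges. -/

namespace Protocol

variable {n : ℕ} {In Out : Type u} {P : Protocol n In Out} {f : ℕ} {ev : ℕ → Event n In}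

-- There are finitely many nodes, so at some single time all faulty ones have crashed, and then they
-- are at most `f`.
open Classical in
theorem card_nonFaulty (hex : P.IsExecution f ev) (hf : 2 * f < n) :
    n < 2 * (Finset.univ.filter fun j => P.NonFaulty ev j).card := by
  have h1 : ∀ j, ∃ k, ¬ P.NonFaulty ev j → j ∈ (P.configAt ev k).crashed := by
    intro j
    by_cases hj : P.NonFaulty ev j
    · exact ⟨0, fun h => absurd hj h⟩
    · unfold NonFaulty at hj
      push Not at hj
      obtain ⟨k, hk⟩ := hj
      exact ⟨k, fun _ => hk⟩
  choose k hk using h1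
  have hsub : (Finset.univ.filter fun j => ¬ P.NonFaulty ev j) ⊆
      (P.configAt ev (Finset.univ.sup k)).crashed := by
    intro j hj
    exact crashed_mono (Finset.le_sup (Finset.mem_univ j)) (hk j (Finset.mem_filter.1 hj).2)
  have h2 := (Finset.card_le_card hsub).trans (hex _).2
  have h3 := Finset.card_filter_add_card_filter_not (s := (Finset.univ : Finset (Fin n)))
    (fun j => P.NonFaulty ev j)
  rw [Finset.card_univ, Fintype.card_fin] at h3
  omega

end Protocol

namespace XProtocol

open Protocol

variable {n : ℕ} {F In Out : Type u} {prog : Fin n → ℕ → In → Prog F Out} {f : ℕ}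
  {ev : ℕ → Event n In}

theorem quiet_stable {k l : ℕ} {i : Fin n} (hkl : k ≤ l)
    (hq : ∀ b, k ≤ b → b < l → Quiet prog ev b i) :
    (st prog ev l i).tag = (st prog ev k i).tag ∧ (st prog ev l i).cont = (st prog ev k i).cont ∧
      (st prog ev k i).acks ⊆ (st prog ev l i).acks := by
  induction l, hkl using Nat.le_induction with
  | base => exact ⟨rfl, rfl, subset_rfl⟩
  | succ l hl ih =>
    obtain ⟨h1, h2, h3⟩ := ih fun b hb hb' => hq b hb (by omega)
    have h := hq l hl (Nat.lt_succ_self l)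
    exact ⟨h.tag.trans h1, h.cont.trans h2, h3.trans h.acks_sub⟩

/-- An exchange of a nonfaulty node takes at most two message delays. -/
theorem exchange_time (hex : (xchProtocol prog).IsExecution f ev) (hf : 2 * f < n)
    (hrel : (xchProtocol prog).Reliable ev) {τ : ℕ → ℝ} {D : ℝ} (hτ : IsTiming τ)
    (hD : (xchProtocol prog).DelayAtMost ev τ D) {i : Fin n}
    (hi : (xchProtocol prog).NonFaulty ev i) {k : ℕ} {s : XState n F Out} {add : Set F}
    {c : Set F → Prog F Out} (hr : Runs prog ev k i s (.xch add c)) :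
    ∃ e s' K, k < e ∧ τ e ≤ τ k + 2 * D ∧ Runs prog ev e i s' (c K) ∧
      ∀ b, k ≤ b → b < e → ∀ o, ¬ (xchProtocol prog).Returns ev b i o := by
  classical
  have hst := hr.state
  have hcont : (st prog ev (k + 1) i).cont = some c := by rw [hst]; rfl
  have htag : (st prog ev (k + 1) i).tag = s.tag + 1 := by rw [hst]; rfl
  -- One delay for the request to `j`, one for its reply. The reply counts only if the exchange has
  -- not ended before.
  have hreply : ∀ j, ∃ l, (xchProtocol prog).NonFaulty ev j → k < l ∧ τ l ≤ τ k + 2 * D ∧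
      ((∀ b, k < b → b ≤ l → Quiet prog ev b i) → j ∈ (st prog ev (l + 1) i).acks) := by
    intro j
    by_cases hj : (xchProtocol prog).NonFaulty ev j
    swap
    · exact ⟨0, fun h => absurd h hj⟩
    obtain ⟨cut, hH⟩ := hr.handles
    obtain rfl := hi.cut_eq hH
    have hsend : (k, (⟨true, s.tag + 1, s.know ∪ add⟩ : XMsg F)) ∈
        ((xchProtocol prog).configAt ev (k + 1)).chan i j := by
      refine chan_of_send hH ?_
      exact List.mem_map.2 ⟨j, List.mem_finRange j, rfl⟩
    obtain ⟨k₁, rest₁, hk₁, hev₁, hch₁⟩ := exists_deliver hrel hj hsend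
    have ht₁ := hD i j hi hj k₁ _ _ (by rw [hch₁]; exact List.mem_cons_self)
    have hsend' := chan_of_send (j := i)
      (m := (⟨false, s.tag + 1, (st prog ev k₁ j).know ∪ (s.know ∪ add)⟩ : XMsg F))
      (Handles.deliver (P := xchProtocol prog) i none _ _ rest₁ hev₁ hch₁)
      (List.mem_singleton.2 rfl)
    obtain ⟨k₂, rest₂, hk₂, hev₂, hch₂⟩ := exists_deliver hrel hi hsend'
    have ht₂ := hD j i hj hi k₂ _ _ (by rw [hch₂]; exact List.mem_cons_self)
    refine ⟨k₂, fun _ => ⟨by omega, by linarith, fun hq => ?_⟩⟩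
    obtain ⟨h1, h2, -⟩ := quiet_stable (k := k + 1) (l := k₂) (by omega)
      fun b hb hb' => hq b hb hb'.le
    refine (hq k₂ (by omega) le_rfl).acks_receive j _ _ none rest₂ hev₂ hch₂ rfl ?_ ?_
    · rw [h1, htag]
    · rw [h2, hcont]; exact Option.some_ne_none c
  choose l hl using hreply
  obtain ⟨j₀, hj₀N⟩ : (Finset.univ.filter fun j => (xchProtocol prog).NonFaulty ev j).Nonempty :=
    ⟨i, by simpa using hi⟩
  obtain ⟨j₁, hj₁, hmax⟩ := Finset.exists_max_image
    (Finset.univ.filter fun j => (xchProtocol prog).NonFaulty ev j) l ⟨j₀, hj₀N⟩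
  obtain ⟨h1, h2, -⟩ := hl j₁ (Finset.mem_filter.1 hj₁).2
  -- If the exchange were still open after the last reply of a nonfaulty node, all nonfaulty nodes
  -- would be acknowledged, against `card_acks`. The first event that is not quiet must end the
  -- exchange, as the client is busy and cannot invoke anything.
  have hnq : ∃ b, k < b ∧ b ≤ l j₁ ∧ ¬ Quiet prog ev b i := by
    by_contra hcon
    push Not at hcon
    have hsub : (Finset.univ.filter fun j => (xchProtocol prog).NonFaulty ev j) ⊆
        (st prog ev (l j₁ + 1) i).acks := by
      intro j hj
      obtain ⟨h3, -, h4⟩ := hl j (Finset.mem_filter.1 hj).2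
      have hle := hmax j hj
      have h5 := h4 fun b hb hb' => hcon b hb (hb'.trans hle)
      exact (quiet_stable (k := l j + 1) (l := l j₁ + 1) (by omega)
        fun b hb hb' => hcon b (by omega) (by omega)).2.2 h5
    have h3 := Finset.card_le_card hsub
    have h4 := card_acks (prog := prog) (ev := ev) (l j₁ + 1) i
    have h5 := card_nonFaulty hex hf
    omega
  obtain ⟨h3, h4, h5⟩ := Nat.find_spec hnq
  have hquiet : ∀ b, k < b → b < Nat.find hnq → Quiet prog ev b i := by
    intro b hb hb'
    by_contra hcon
    exact Nat.find_min hnq hb' ⟨hb, by omega, hcon⟩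
  have hc := (quiet_stable (k := k + 1) (l := Nat.find hnq) h3 hquiet).2.1
  rw [hcont] at hc
  refine ⟨Nat.find hnq, ?_⟩
  rcases node_step (prog := prog) (ev := ev) (Nat.find hnq) i with hq | ⟨x, hx, -⟩ |
    ⟨j, t, m, c', -, -, -, hc', -, hr'⟩
  · exact absurd hq h5
  · rw [cont_eq_none_of_invokes hex hx] at hc; cases hc
  · rw [hc] at hc'; cases hc'
    refine ⟨_, _, h3, (hτ.1 h4).trans h2, hr', fun b hb hb' o ho => ?_⟩
    rcases hb.eq_or_lt with rfl | hb
    · have := hr.returns ho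
      cases this
    · exact (hquiet b hb hb').no_return o ho

theorem run_time (hex : (xchProtocol prog).IsExecution f ev) (hf : 2 * f < n)
    (hrel : (xchProtocol prog).Reliable ev) {τ : ℕ → ℝ} {D : ℝ} (hτ : IsTiming τ) (hD₀ : 0 ≤ D)
    (hD : (xchProtocol prog).DelayAtMost ev τ D) {i : Fin n}
    (hi : (xchProtocol prog).NonFaulty ev i) {m : ℕ} {p : Prog F Out} (hp : DepthLE m p) :
    ∀ {k : ℕ} {s : XState n F Out}, Runs prog ev k i s p →
    ∃ b o, k ≤ b ∧ τ b ≤ τ k + 2 * m * D ∧ (xchProtocol prog).Returns ev b i o ∧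
      ∀ b', k ≤ b' → b' < b → ∀ o, ¬ (xchProtocol prog).Returns ev b' i o := by
  induction hp with
  | ret m add o =>
    intro k s hr
    obtain ⟨cut, hH⟩ := hr.handles
    obtain rfl := hi.cut_eq hH
    refine ⟨k, o, le_rfl, ?_, hH.returns rfl, fun b h1 h2 => by omega⟩
    have : (0 : ℝ) ≤ 2 * m * D := by positivity
    linarith
  | xch m add c h ih =>
    intro k s hr
    obtain ⟨e, s', K, he, hte, hr', hno⟩ := exchange_time hex hf hrel hτ hD hi hr
    obtain ⟨b, o, hb, htb, hret, hno'⟩ := ih K hr'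
    refine ⟨b, o, by omega, ?_, hret, fun b' h1 h2 => ?_⟩
    · push_cast; linarith
    · rcases lt_or_ge b' e with h3 | h3
      · exact hno b' h1 h3
      · exact hno' b' h3 h2

theorem completesWithin (hf : 2 * f < n) {m : ℕ} (hm : ∀ i c x, DepthLE m (prog i c x)) :
    (xchProtocol prog).CompletesWithin f (2 * m) := by
  intro ev hex hrel τ D hτ hD₀ hD a i x ha hi
  obtain ⟨cut, hev⟩ := ha
  have hr : Runs prog ev a i { st prog ev a i with cnt := (st prog ev a i).cnt + 1 }
      (prog i (st prog ev a i).cnt x) :=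
    ⟨⟨cut, .invoke x cut hev⟩, rfl, subset_rfl⟩
  obtain ⟨b, o, hb, htb, hret, hno⟩ := run_time hex hf hrel hτ hD₀ hD hi (hm i _ x) hr
  exact ⟨b, o, ⟨⟨cut, hev⟩, hb, hret, hno⟩, htb⟩

end XProtocol

/-! ## The snapshot algorithm: rounds of lattice agreement on sets of updates -/

/-- An update: the node, the number of its earlier operations, and the value. -/
abbrev Upd (n : ℕ) (V : Type u) : Type u := Fin n × ℕ × V

/-- Facts that nodes know. In each round, lattice agreement is reached by descending a binary tree,
whose vertices are given by the paths to the root. -/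
inductive SFact (n : ℕ) (V : Type u) : Type u where
  /-- `u` is an update -/
  | upd (u : Upd n V)
  /-- in round `r`, node `p` has entered the vertex `π` with the set `X` of round inputs -/
  | ent (r : ℕ) (π : List Bool) (p : Fin n) (X : Set (Set (Upd n V)))
  /-- round `r` has been completed with output `w` -/
  | fin (r : ℕ) (w : Set (Upd n V))

namespace Snap

variable {n : ℕ} {V : Type u}

/-- The known updates. -/
def pool (K : Set (SFact n V)) : Set (Upd n V) := {u | .upd u ∈ K}

/-- The inputs of round `r` that are known to have entered the vertex `π`. -/
def acc (K : Set (SFact n V)) (r : ℕ) (π : List Bool) : Set (Set (Upd n V)) :=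
  {x | ∃ p X, .ent r π p X ∈ K ∧ x ∈ X}

/-- The latest round that is known to be completed, or `0`. -/
noncomputable def dn (K : Set (SFact n V)) : ℕ := sSup {r | ∃ w, .fin r w ∈ K}

/-- At the vertex `π`, sets have more than `lo L π` elements. -/
def lo (L : ℕ) : List Bool → ℕ
  | [] => 0
  | b :: π => lo L π + if b then 2 ^ (L - π.length - 1) else 0

/-- The threshold for the classification at the vertex `π`. -/
def mid (L : ℕ) (π : List Bool) : ℕ := lo L π + 2 ^ (L - π.length - 1)

theorem pool_mono {K K' : Set (SFact n V)} (h : K ⊆ K') : pool K ⊆ pool K' := fun _ hu => h hu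

theorem acc_mono {K K' : Set (SFact n V)} (h : K ⊆ K') (r : ℕ) (π : List Bool) :
    acc K r π ⊆ acc K' r π := fun _ ⟨p, X, hX, hx⟩ => ⟨p, X, h hX, hx⟩

/-- The bound `N` is essential: `sSup` of an unbounded set of naturals is `0`. -/
theorem le_dn {K : Set (SFact n V)} {N r : ℕ} {w : Set (Upd n V)}
    (hN : ∀ r w, .fin r w ∈ K → r ≤ N) (h : .fin r w ∈ K) : r ≤ dn K :=
  le_csSup ⟨N, fun _ ⟨w', h'⟩ => hN _ w' h'⟩ ⟨w, h⟩

/-- The value `0` is the default for empty and unbounded sets; any other value is attained. Actual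
rounds are numbered from `1`. -/
theorem dn_mem {K : Set (SFact n V)} (h : dn K ≠ 0) : ∃ w, .fin (dn K) w ∈ K := by
  by_cases hb : BddAbove {r | ∃ w : Set (Upd n V), .fin r w ∈ K}
  · refine Nat.sSup_mem ?_ hb
    by_contra hne
    rw [Set.not_nonempty_iff_eq_empty] at hne
    exact h (by rw [dn, hne]; exact csSup_empty)
  · exact absurd (Nat.sSup_of_not_bddAbove hb) h

/-- Some node knows `φ` at some time. -/
def Known (Kn : ℕ → Fin n → Set (SFact n V)) (φ : SFact n V) : Prop := ∃ k i, φ ∈ Kn k i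

/-- The record of how node `p` entered a vertex of the tree. -/
def EntRec (L : ℕ) (Kn : ℕ → Fin n → Set (SFact n V)) (r : ℕ) (p : Fin n)
    (X : Set (Set (Upd n V))) : List Bool → Prop
  | [] => (∃ s e Ks Ke, Exchange Kn s e Ks Ke ∧ X = {pool Ke} ∧
        (r = 1 ∨ ∃ r' w, r = r' + 1 ∧ .fin r' w ∈ Ks)) ∧
      ∃ t, (∀ X', .ent r [] p X' ∉ Kn t p) ∧ .ent r [] p X ∈ Kn (t + 1) p ∧
        ∀ X', .ent r [] p X' ∈ Kn (t + 1) p → X' = X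
  | false :: π => Known Kn (.ent r π p X) ∧
      ∃ s₁ e₁ Ks₁ Ke₁ s₂ e₂ Ks₂ Ke₂, Exchange Kn s₁ e₁ Ks₁ Ke₁ ∧ Exchange Kn s₂ e₂ Ks₂ Ke₂ ∧
        e₁ ≤ s₂ ∧ .ent r π p X ∈ Ks₁ ∧ .ent r π p X ∈ Ks₂ ∧ (∃ k i, Ke₂ ⊆ Kn k i) ∧
        (acc Ke₂ r π).ncard ≤ mid L π
  | true :: π => ∃ s e Ks Ke, Exchange Kn s e Ks Ke ∧ X = acc Ke r π ∧ (∃ k i, Ke ⊆ Kn k i) ∧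
      mid L π < (acc Ks r π).ncard ∧ ∃ X₀, .ent r π p X₀ ∈ Ks

/-- The record of how round `r` was completed. -/
def FinRec (L : ℕ) (Kn : ℕ → Fin n → Set (SFact n V)) (k r : ℕ) (w : Set (Upd n V)) : Prop :=
  (∃ π p X, π.length = L ∧ w = Set.sUnion X ∧ Known Kn (.ent r π p X)) ∧
    ∃ s e Ks Ke, e ≤ k ∧ Exchange Kn s e Ks Ke ∧ w ⊆ pool Ks ∧ ∀ r' w', .fin r' w' ∈ Ke → r' < r

/-- What holds for a fact that is known before event `k`, where `I k u` means that the update `u` has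
been invoked before. -/
def OK (L : ℕ) (Kn : ℕ → Fin n → Set (SFact n V)) (I : ℕ → Upd n V → Prop) (k : ℕ) :
    SFact n V → Prop
  | .upd u => I k u
  | .ent r π p X => (∀ x ∈ X, ∀ u ∈ x, I k u) ∧ EntRec L Kn r p X π
  | .fin r w => 1 ≤ r ∧ r ≤ k ∧ (∀ u ∈ w, I k u) ∧ FinRec L Kn k r w

/-! ### Lattice agreement: the tree within a round, and the chain of outputs across rounds. -/

section LatticeAgreement

variable {L : ℕ} {Kn : ℕ → Fin n → Set (SFact n V)} {I : ℕ → Upd n V → Prop}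

/-- The inputs that enter the vertex `π` in round `r`. -/
def reach (Kn : ℕ → Fin n → Set (SFact n V)) (r : ℕ) (π : List Bool) : Set (Set (Upd n V)) :=
  {x | ∃ p X, Known Kn (.ent r π p X) ∧ x ∈ X}

theorem subset_reach {r : ℕ} {π : List Bool} {p : Fin n} {X : Set (Set (Upd n V))}
    (h : Known Kn (.ent r π p X)) : X ⊆ reach Kn r π := fun _ hx => ⟨p, X, h, hx⟩

theorem acc_subset_reach {K : Set (SFact n V)} (h : ∃ k i, K ⊆ Kn k i) (r : ℕ) (π : List Bool) :
    acc K r π ⊆ reach Kn r π := by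
  obtain ⟨k, i, h⟩ := h
  rintro x ⟨p, X, hX, hx⟩
  exact ⟨p, X, ⟨k, i, h hX⟩, hx⟩

theorem entRec (hOK : ∀ k i, ∀ φ ∈ Kn k i, OK L Kn I k φ) {r : ℕ} {π : List Bool} {p : Fin n}
    {X : Set (Set (Upd n V))} (h : Known Kn (.ent r π p X)) : EntRec L Kn r p X π := by
  obtain ⟨k, i, h⟩ := h
  exact (hOK k i _ h).2

theorem finRec (hOK : ∀ k i, ∀ φ ∈ Kn k i, OK L Kn I k φ) {r : ℕ} {w : Set (Upd n V)}
    (h : Known Kn (.fin r w)) : 1 ≤ r ∧ ∃ k, FinRec L Kn k r w := by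
  obtain ⟨k, i, h⟩ := h
  exact ⟨(hOK k i _ h).1, k, (hOK k i _ h).2.2.2⟩

variable (hOK : ∀ k i, ∀ φ ∈ Kn k i, OK L Kn I k φ)

include hOK

/-- On the `true` side a node's own announcement is among those it collects, so no input is lost on
the way down. -/
theorem ent_cons {r : ℕ} {b : Bool} {π : List Bool} {p : Fin n} {X : Set (Set (Upd n V))}
    (h : Known Kn (.ent r (b :: π) p X)) :
    ∃ X₀, Known Kn (.ent r π p X₀) ∧ X₀ ⊆ X ∧ X ⊆ reach Kn r π := by
  have hrec := entRec hOK h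
  cases b with
  | false => exact ⟨X, hrec.1, subset_rfl, subset_reach hrec.1⟩
  | true =>
    obtain ⟨s, e, Ks, Ke, hE, rfl, hK, -, X₀, hX₀⟩ := hrec
    refine ⟨X₀, ?_, fun x hx => ⟨p, X₀, hE.subset hX₀, hx⟩, acc_subset_reach hK r π⟩
    obtain ⟨k, i, hK⟩ := hK
    exact ⟨k, i, hK (hE.subset hX₀)⟩

theorem reach_cons (r : ℕ) (b : Bool) (π : List Bool) : reach Kn r (b :: π) ⊆ reach Kn r π := by
  rintro x ⟨p, X, hX, hx⟩
  obtain ⟨-, -, -, h⟩ := ent_cons hOK hX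
  exact h hx

theorem reach_subset_root (r : ℕ) (π : List Bool) : reach Kn r π ⊆ reach Kn r [] := by
  induction π with
  | nil => exact subset_rfl
  | cons b π ih => exact (reach_cons hOK r b π).trans ih

variable (hmono : ∀ j, Monotone fun k => Kn k j)

include hmono

/-- Each record names the moment when `p` first knew a root entry of its own in round `r`; by
monotonicity there is only one such moment. -/
theorem root_unique {r : ℕ} {p : Fin n} {X X' : Set (Set (Upd n V))}
    (h : Known Kn (.ent r [] p X)) (h' : Known Kn (.ent r [] p X')) : X = X' := by
  obtain ⟨-, t, h1, h2, h3⟩ := entRec hOK h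
  obtain ⟨-, t', h1', h2', h3'⟩ := entRec hOK h'
  rcases lt_trichotomy t t' with hlt | rfl | hlt
  · exact absurd (hmono p (Nat.succ_le_of_lt hlt) h2) (h1' X)
  · exact h3' X h2
  · exact absurd (hmono p (Nat.succ_le_of_lt hlt) h2') (h1 X')

/-- Each node contributes at most one input to a round. -/
theorem root_reach (r : ℕ) : (reach Kn r []).Finite ∧ (reach Kn r []).ncard ≤ n := by
  classical
  let g : Fin n → Set (Upd n V) := fun p =>
    if h : ∃ x, Known Kn (.ent r [] p {x}) then h.choose else ∅
  have hsub : reach Kn r [] ⊆ Set.range g := by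
    rintro x ⟨p, X, hX, hx⟩
    obtain ⟨⟨s, e, Ks, Ke, -, rfl, -⟩, -⟩ := entRec hOK hX
    rw [Set.mem_singleton_iff] at hx
    subst hx
    have hex : ∃ x, Known Kn (.ent r [] p {x}) := ⟨_, hX⟩
    refine ⟨p, ?_⟩
    simp only [g]
    rw [dif_pos hex]
    exact Set.singleton_injective (root_unique hOK hmono hex.choose_spec hX)
  refine ⟨(Set.finite_range g).subset hsub, ?_⟩
  refine (Set.ncard_le_ncard hsub (Set.finite_range g)).trans ?_
  rw [← Set.image_univ]
  refine (Set.ncard_image_le Set.finite_univ).trans ?_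
  rw [Set.ncard_univ, Nat.card_eq_fintype_card, Fintype.card_fin]

/-- `Set.ncard` is `0` on infinite sets, so comparisons of cardinalities rely on this. -/
theorem finite_reach (r : ℕ) (π : List Bool) : (reach Kn r π).Finite :=
  (root_reach hOK hmono r).1.subset (reach_subset_root hOK r π)

/-- Among the nodes that turn to `false`, take one whose announcing exchange ends last. Its counting
exchange starts after all the other announcements have reached majorities, so it counts all inputs
concerned, and it found at most `mid L π`. -/
theorem reach_false {r : ℕ} {π : List Bool} : (reach Kn r (false :: π)).ncard ≤ mid L π := by
  have key : ∀ x ∈ reach Kn r (false :: π), ∃ (e₁ : ℕ) (Ke₂ : Set (SFact n V)),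
      (∃ s₁ Ks₁ Ke₁, Exchange Kn s₁ e₁ Ks₁ Ke₁ ∧ ∃ p X, .ent r π p X ∈ Ks₁ ∧ x ∈ X) ∧
      (∃ s₂ e₂ Ks₂, Exchange Kn s₂ e₂ Ks₂ Ke₂ ∧ e₁ ≤ s₂) ∧ (∃ k i, Ke₂ ⊆ Kn k i) ∧
      (acc Ke₂ r π).ncard ≤ mid L π := by
    rintro x ⟨p, X, hX, hx⟩
    obtain ⟨-, s₁, e₁, Ks₁, Ke₁, s₂, e₂, Ks₂, Ke₂, h1, h2, h3, h4, -, h5, h6⟩ := entRec hOK hX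
    exact ⟨e₁, Ke₂, ⟨s₁, Ks₁, Ke₁, h1, p, X, h4, hx⟩, ⟨s₂, e₂, Ks₂, h2, h3⟩, h5, h6⟩
  rcases (reach Kn r (false :: π)).eq_empty_or_nonempty with he | hne
  · rw [he, Set.ncard_empty]; exact Nat.zero_le _
  choose! e₁ Ke₂ h using key
  obtain ⟨x₀, hx₀, hmax⟩ := Set.exists_max_image _ e₁ (finite_reach hOK hmono r (false :: π)) hne
  obtain ⟨-, ⟨s₂, e₂, Ks₂, hE₂, hle⟩, hK, hcard⟩ := h x₀ hx₀
  refine le_trans (Set.ncard_le_ncard ?_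
    ((finite_reach hOK hmono r π).subset (acc_subset_reach hK r π))) hcard
  intro x hx
  obtain ⟨⟨s₁, Ks₁, Ke₁, hE₁, p, X, hX, hxX⟩, -⟩ := h x hx
  exact ⟨p, X, hE₁.of_le hmono hE₂ ((hmax x hx).trans hle) hX, hxX⟩

/-- At depth `d` the cardinalities lie in an interval of length `2 ^ (L - d)` above `lo L π`.
Turning to `false` keeps the lower half by `reach_false`; turning to `true` raises `lo` by half the
length. -/
theorem ncard_reach (hL : n ≤ 2 ^ L) (r : ℕ) (π : List Bool) (hπ : π.length ≤ L) :
    (reach Kn r π).ncard ≤ lo L π + 2 ^ (L - π.length) := by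
  induction π with
  | nil => simpa [lo] using (root_reach hOK hmono r).2.trans hL
  | cons b π ih =>
    rw [List.length_cons] at hπ
    have he : L - π.length = (L - π.length - 1) + 1 := by omega
    have he' : L - (b :: π).length = L - π.length - 1 := by rw [List.length_cons]; omega
    rw [he']
    cases b with
    | false => simpa [lo, mid] using reach_false hOK hmono (r := r) (π := π)
    | true =>
      refine (Set.ncard_le_ncard (reach_cons hOK r true π) (finite_reach hOK hmono r π)).trans
        ((ih (by omega)).trans ?_)
      rw [he, pow_succ]
      simp only [lo, if_true, Nat.add_sub_cancel]
      omega

/-- Turning to `true` requires a count above `mid L π`, and the extra exchange can only add inputs.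
-/
theorem lo_lt_ncard {r : ℕ} {π : List Bool} {p : Fin n} {X : Set (Set (Upd n V))}
    (h : Known Kn (.ent r π p X)) : lo L π < X.ncard := by
  induction π generalizing X with
  | nil =>
    obtain ⟨⟨s, e, Ks, Ke, -, rfl, -⟩, -⟩ := entRec hOK h
    simp [lo]
  | cons b π ih =>
    have hrec := entRec hOK h
    cases b with
    | false => simpa [lo] using ih hrec.1
    | true =>
      obtain ⟨s, e, Ks, Ke, hE, rfl, hK, hcard, -⟩ := hrec
      refine lt_of_lt_of_le ?_ (Set.ncard_le_ncard (acc_mono hE.subset r π)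
        ((finite_reach hOK hmono r π).subset (acc_subset_reach hK r π)))
      simpa [lo, mid] using hcard

/-- Compare the counting exchange of a node turning to `false` with the extra exchange of one
turning to `true`. Either the latter collects the former's announcement, or the former sees the more
than `mid L π` inputs that the latter had counted, which contradicts its turn. -/
theorem reach_false_subset {r : ℕ} {π : List Bool} {p : Fin n} {X : Set (Set (Upd n V))}
    (h : Known Kn (.ent r (true :: π) p X)) : reach Kn r (false :: π) ⊆ X := by
  rintro x ⟨q, Y, hY, hx⟩
  obtain ⟨s, e, Ks, Ke, hE, rfl, hK, hcard, -⟩ := entRec hOK h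
  obtain ⟨-, s₁, e₁, Ks₁, Ke₁, s₂, e₂, Ks₂, Ke₂, -, hE₂, -, -, h4, h5, h6⟩ := entRec hOK hY
  rcases hE₂.comparable hmono hE with hsub | hsub
  · exact ⟨q, Y, hsub h4, hx⟩
  · have := Set.ncard_le_ncard (acc_mono hsub r π)
      ((finite_reach hOK hmono r π).subset (acc_subset_reach h5 r π))
    omega

/-- The head of a path is its last turn. Distinct paths of equal length part at a common ancestor,
where `reach_false_subset` applies; below it sets only grow and `reach` only shrinks. -/
theorem reach_comparable (r : ℕ) : ∀ π π' : List Bool, π.length = π'.length → π = π' ∨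
    (∀ p X, Known Kn (.ent r π' p X) → reach Kn r π ⊆ X) ∨
    (∀ p X, Known Kn (.ent r π p X) → reach Kn r π' ⊆ X) := by
  intro π
  induction π with
  | nil =>
    intro π' h
    exact .inl (List.eq_nil_of_length_eq_zero h.symm).symm
  | cons b π ih =>
    rintro (_ | ⟨b', π'⟩) h
    · simp at h
    rcases ih π' (by simpa using h) with rfl | h1 | h1
    · cases b <;> cases b'
      · exact .inl rfl
      · exact .inr (.inl fun p X hX => reach_false_subset hOK hmono hX)
      · exact .inr (.inr fun p X hX => reach_false_subset hOK hmono hX)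
      · exact .inl rfl
    · right; left
      intro p X hX
      obtain ⟨X₀, hX₀, hsub, -⟩ := ent_cons hOK hX
      exact ((reach_cons hOK r b π).trans (h1 p X₀ hX₀)).trans hsub
    · right; right
      intro p X hX
      obtain ⟨X₀, hX₀, hsub, -⟩ := ent_cons hOK hX
      exact ((reach_cons hOK r b' π').trans (h1 p X₀ hX₀)).trans hsub

/-- The sets with which nodes reach leaves of the tree are comparable. -/
theorem leaf_comparable (hL : n ≤ 2 ^ L) {r : ℕ} {π π' : List Bool} {p p' : Fin n}
    {X X' : Set (Set (Upd n V))} (hπ : π.length = L) (hπ' : π'.length = L)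
    (h : Known Kn (.ent r π p X)) (h' : Known Kn (.ent r π' p' X')) : X ⊆ X' ∨ X' ⊆ X := by
  -- At depth `L` the interval has length `2 ^ 0 = 1`, so `X` has as many elements as the whole of
  -- `reach`.
  have hleaf : ∀ {p X}, Known Kn (.ent r π p X) → X = reach Kn r π := by
    intro p X hX
    refine Set.eq_of_subset_of_ncard_le (subset_reach hX) ?_ (finite_reach hOK hmono r π)
    have h1 := ncard_reach hOK hmono hL r π hπ.le
    have h2 := lo_lt_ncard hOK hmono hX
    rw [hπ, Nat.sub_self, pow_zero] at h1
    omega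
  rcases reach_comparable hOK hmono r π π' (hπ.trans hπ'.symm) with rfl | h1 | h1
  · rw [hleaf h, hleaf h']; exact .inl subset_rfl
  · exact .inl ((subset_reach h).trans (h1 p' X' h'))
  · exact .inr ((subset_reach h').trans (h1 p X h))

/-- If `U` was known to a majority before the completion of round `t + 1`, then it is contained in
the inputs of all rounds from `t + 2` on. -/
theorem subset_input {s e t : ℕ} {Ks Ke : Set (SFact n V)} {U : Set (Upd n V)}
    (hE : Exchange Kn s e Ks Ke) (hU : U ⊆ pool Ks) (ht : ∀ r w, .fin r w ∈ Ke → r < t)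
    (ht₁ : 1 ≤ t) {r : ℕ} (hr : t < r) {x : Set (Upd n V)} (hx : x ∈ reach Kn r []) : U ⊆ x := by
  obtain ⟨p, X, hX, hx⟩ := hx
  obtain ⟨⟨s', e', Ks', Ke', hE', rfl, hr'⟩, -⟩ := entRec hOK hX
  rw [Set.mem_singleton_iff] at hx
  subst hx
  rcases hE.comparable hmono hE' with hsub | hsub
  · exact hU.trans (pool_mono hsub)
  -- Otherwise the completion of round `r - 1 ≥ t`, known when the input was collected, would be in
  -- `Ke`. Round `1` is ruled out by `1 ≤ t < r`.
  · rcases hr' with rfl | ⟨r', w, rfl, hw⟩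
    · omega
    · have := ht r' w (hsub hw)
      omega

/-- Sets at vertices are nonempty by `lo_lt_ncard`. This carries lower bounds from inputs over to
outputs. -/
theorem exists_input {r : ℕ} {w : Set (Upd n V)} (h : Known Kn (.fin r w)) :
    ∃ x ∈ reach Kn r [], x ⊆ w := by
  obtain ⟨-, k, ⟨π, p, X, -, rfl, hX⟩, -⟩ := finRec hOK h
  have hne : X.Nonempty := by
    by_contra hcon
    rw [Set.not_nonempty_iff_eq_empty] at hcon
    have := lo_lt_ncard hOK hmono hX
    rw [hcon, Set.ncard_empty] at this
    omega
  obtain ⟨x, hx⟩ := hne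
  exact ⟨x, reach_subset_root hOK r π (subset_reach hX hx), Set.subset_sUnion_of_mem hx⟩

theorem subset_fin {s e t : ℕ} {Ks Ke : Set (SFact n V)} {U : Set (Upd n V)}
    (hE : Exchange Kn s e Ks Ke) (hU : U ⊆ pool Ks) (ht : ∀ r w, .fin r w ∈ Ke → r < t)
    (ht₁ : 1 ≤ t) {r : ℕ} (hr : t < r) {w : Set (Upd n V)} (hw : Known Kn (.fin r w)) : U ⊆ w := by
  obtain ⟨x, hx, hxw⟩ := exists_input hOK hmono hw
  exact (subset_input hOK hmono hE hU ht ht₁ hr hx).trans hxw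

/-- The outputs of completed rounds are comparable. -/
theorem fin_comparable (hL : n ≤ 2 ^ L) {r r' : ℕ} {w w' : Set (Upd n V)}
    (h : Known Kn (.fin r w)) (h' : Known Kn (.fin r' w')) : w ⊆ w' ∨ w' ⊆ w := by
  obtain ⟨hr, k, ⟨π, p, X, hπ, hX, hent⟩, s, e, Ks, Ke, -, hE, hU, ht⟩ := finRec hOK h
  obtain ⟨hr', k', ⟨π', p', X', hπ', hX', hent'⟩, s', e', Ks', Ke', -, hE', hU', ht'⟩ := finRec hOK h'
  -- The lower round's output was spread before that round was known as completed, hence lies in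
  -- later outputs; equal rounds are compared at the leaves.
  rcases lt_trichotomy r r' with hlt | rfl | hlt
  · exact .inl (subset_fin hOK hmono hE hU ht hr hlt h')
  · rw [hX, hX']
    rcases leaf_comparable hOK hmono hL hπ hπ' hent hent' with hs | hs
    · exact .inl (Set.sUnion_subset_sUnion hs)
    · exact .inr (Set.sUnion_subset_sUnion hs)
  · exact .inr (subset_fin hOK hmono hE' hU' ht' hr' hlt h)

end LatticeAgreement

end Snap

/-! ### The snapshot program and the number of its exchanges. -/

namespace Snap

variable {n : ℕ} {V : Type u}

open Classical in
/-- The value of the last update of node `j` in `w`, or the initial value. -/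
noncomputable def lastVal (v₀ : Fin n → V) (w : Set (Upd n V)) (j : Fin n) : V :=
  if h : ∃ v s, (j, s, v) ∈ w ∧ ∀ s' v', (j, s', v') ∈ w → s' ≤ s then h.choose else v₀ j

/-- The response to an operation whose view is `w`. -/
noncomputable def resp (v₀ : Fin n → V) : SnapOp V → Set (Upd n V) → SnapResp n V
  | .update _, _ => .ack
  | .scan, w => .view (lastVal v₀ w)

open Classical in
/-- An output of the latest completed round. -/
noncomputable def latest (K : Set (SFact n V)) : Set (Upd n V) :=
  if h : ∃ w, SFact.fin (dn K) w ∈ K then h.choose else ∅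

variable {Out : Type u}

/-- Lattice agreement of node `i` in round `r`: descend the tree from the vertex `π` with the set
`X`, and continue with the set with which a leaf is reached. -/
noncomputable def agree (L r : ℕ) (i : Fin n) (κ : Set (Set (Upd n V)) → Prog (SFact n V) Out) :
    ℕ → List Bool → Set (Set (Upd n V)) → Prog (SFact n V) Out
  | 0, π, X => .xch {.ent r π i X} fun _ => κ X
  | l + 1, π, X => .xch {.ent r π i X} fun _ => .xch ∅ fun K =>
    if (acc K r π).ncard ≤ mid L π then agree L r i κ l (false :: π) X
    else .xch ∅ fun K => agree L r i κ l (true :: π) (acc K r π)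

/-- Node `i` tries to complete a round at most `m` times, and otherwise adopts an output of the latest
completed round. -/
noncomputable def attempt (L : ℕ) (i : Fin n) (out : Set (Upd n V) → Out) :
    ℕ → Set (SFact n V) → Prog (SFact n V) Out
  | 0, K => .ret ∅ (out (latest K))
  | m + 1, K => .xch ∅ fun K₁ => agree L (dn K + 1) i
    (fun X => .xch (SFact.upd '' Set.sUnion X) fun K₂ =>
      if dn K₂ < dn K + 1 then .ret {.fin (dn K + 1) (Set.sUnion X)} (out (Set.sUnion X))
      else attempt L i out m K₂) L [] {pool K₁}

/-- The facts that the invocation of an operation creates. -/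
def opFacts (i : Fin n) (c : ℕ) : SnapOp V → Set (SFact n V)
  | .update v => {.upd (i, c, v)}
  | .scan => ∅

/-- The snapshot algorithm. -/
noncomputable def snapProg (L : ℕ) (v₀ : Fin n → V) (i : Fin n) (c : ℕ) (x : SnapOp V) :
    Prog (SFact n V) (SnapResp n V) :=
  .xch (opFacts i c x) fun _ => .xch ∅ fun K => attempt L i (resp v₀ x) 2 K

section Depth

open XProtocol

/-- Three exchanges per level at most, and one for the announcement at the leaf. -/
theorem depth_agree {L r : ℕ} {i : Fin n} {κ : Set (Set (Upd n V)) → Prog (SFact n V) Out} {m : ℕ}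
    (h : ∀ X, DepthLE m (κ X)) (l : ℕ) (π : List Bool) (X : Set (Set (Upd n V))) :
    DepthLE (m + 3 * l + 1) (agree L r i κ l π X) := by
  induction l generalizing π X with
  | zero => exact .xch _ _ _ fun _ => h X
  | succ l ih =>
    refine .xch (m + 3 * l + 3) _ _ fun _ => .xch (m + 3 * l + 2) _ _ fun K => ?_
    split_ifs
    · exact (ih _ _).mono (by omega)
    · exact .xch (m + 3 * l + 1) _ _ fun K => ih _ _

/-- An attempt collects its input (1), descends the tree (`3 * L + 1`) and spreads its output (1).
-/
theorem depth_attempt (L : ℕ) (i : Fin n) (out : Set (Upd n V) → Out) (m : ℕ)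
    (K : Set (SFact n V)) : DepthLE (m * (3 * L + 3)) (attempt L i out m K) := by
  induction m generalizing K with
  | zero => exact .ret _ _ _
  | succ m ih =>
    have he : (m + 1) * (3 * L + 3) = (m * (3 * L + 3) + 1) + 3 * L + 1 + 1 := by ring
    rw [he]
    refine .xch _ _ _ fun K₁ => depth_agree (fun X => .xch _ _ _ fun K₂ => ?_) L [] _
    split_ifs
    · exact .ret _ _ _
    · exact ih K₂

theorem depth_snapProg (L : ℕ) (v₀ : Fin n → V) (i : Fin n) (c : ℕ) (x : SnapOp V) :
    DepthLE (6 * L + 8) (snapProg L v₀ i c x) := by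
  have he : 6 * L + 8 = 2 * (3 * L + 3) + 1 + 1 := by ring
  rw [he]
  exact .xch _ _ _ fun _ => .xch _ _ _ fun K => depth_attempt L i _ 2 K

end Depth

/-- The updates that the view of an operation of node `i` invoked in event `a` has to contain. -/
def base (Kn : ℕ → Fin n → Set (SFact n V)) (a : ℕ) (i : Fin n) : Set (Upd n V) :=
  {u | (∃ q r w, .fin r w ∈ Kn a q ∧ u ∈ w) ∨ .upd u ∈ Kn (a + 1) i}

/-- A majority knew `U` before the completion of round `t`. -/
def KnownBefore (Kn : ℕ → Fin n → Set (SFact n V)) (U : Set (Upd n V)) (t : ℕ) : Prop :=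
  1 ≤ t ∧ ∃ s e Ks Ke, Exchange Kn s e Ks Ke ∧ U ⊆ pool Ks ∧ ∀ r w, .fin r w ∈ Ke → r < t

/-- The assertions for the snapshot algorithm. -/
def assertions (L : ℕ) (v₀ : Fin n → V) (Kn : ℕ → Fin n → Set (SFact n V))
    (I : ℕ → Upd n V → Prop) : Assertions n (SFact n V) (SnapOp V) (SnapResp n V) where
  Kn := Kn
  OK := OK L Kn I
  own φ i := ∃ r X, φ = .ent r [] i X
  Idle i K := ∀ r X, .ent r [] i X ∈ K → ∃ r' w, r ≤ r' ∧ .fin r' w ∈ K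
  Post i a x b o := ∃ r w, .fin r w ∈ Kn (b + 1) i ∧ o = resp v₀ x w ∧
    (base Kn a i ⊆ w ∨ ∃ t, KnownBefore Kn (base Kn a i) t ∧ t < r)

/-! ### Verification of the program by weakest preconditions. -/

section Correct

variable {L : ℕ} {v₀ : Fin n → V} {Kn : ℕ → Fin n → Set (SFact n V)} {I : ℕ → Upd n V → Prop}
  (hI : ∀ k k' u, k ≤ k' → I k u → I k' u)

theorem OK.mono (hI : ∀ k k' u, k ≤ k' → I k u → I k' u) {k k' : ℕ} (hk : k ≤ k')
    {φ : SFact n V} (h : OK L Kn I k φ) : OK L Kn I k' φ := by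
  cases φ with
  | upd u => exact hI _ _ _ hk h
  | ent r π p X => exact ⟨fun x hx u hu => hI _ _ _ hk (h.1 x hx u hu), h.2⟩
  | fin r w =>
    obtain ⟨h1, h2, h3, h4, s, e, Ks, Ke, h5, h6⟩ := h
    exact ⟨h1, h2.trans hk, fun u hu => hI _ _ _ hk (h3 u hu), h4, s, e, Ks, Ke, h5.trans hk, h6⟩

/-- Here the clause `r ≤ k` of `OK` is used: it bounds the known rounds. -/
theorem le_dn_of_OK {K : Set (SFact n V)} {t r : ℕ} {w : Set (Upd n V)}
    (hK : ∀ φ ∈ K, OK L Kn I t φ) (h : .fin r w ∈ K) : r ≤ dn K :=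
  le_dn (N := t) (fun _ _ h' => (hK _ h').2.1) h

theorem dn_le_of_OK {K : Set (SFact n V)} {t : ℕ} (hK : ∀ φ ∈ K, OK L Kn I t φ) : dn K ≤ t := by
  by_cases h : dn K = 0
  · omega
  · obtain ⟨w, hw⟩ := dn_mem h
    exact (hK _ hw).2.1

include hI

/-- The exchanges made at a vertex are those that `EntRec` asks for at its child, while `U` stays
covered and no root of a round beyond `r` is entered. The record of the initial vertex is left as a
hypothesis, since for the root it depends on the knowledge at the moment of entry. -/
theorem wp_agree {i : Fin n} {a : ℕ} {x : SnapOp V} {U : Set (Upd n V)} {r t₀ : ℕ}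
    {κ : Set (Set (Upd n V)) → Prog (SFact n V) (SnapResp n V)}
    (hκ : ∀ X π t K, π.length = L → Known Kn (.ent r π i X) → U ⊆ Set.sUnion X →
      (∀ x ∈ X, ∀ u ∈ x, I t u) → (∀ r' X', .ent r' [] i X' ∈ K → r' ≤ r) → t₀ < t →
      (assertions L v₀ Kn I).wp i a x (κ X) t K)
    (l : ℕ) : ∀ (π : List Bool) (X : Set (Set (Upd n V))) (t : ℕ) (K : Set (SFact n V)),
      π.length + l = L → (Kn (t + 1) i = K ∪ {.ent r π i X} → EntRec L Kn r i X π) →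
      U ⊆ Set.sUnion X → (∀ x ∈ X, ∀ u ∈ x, I t u) →
      (∀ r' X', .ent r' [] i X' ∈ K → r' ≤ r) → t₀ < t →
      (assertions L v₀ Kn I).wp i a x (agree L r i κ l π X) t K := by
  have hadd : ∀ {π X t}, EntRec L Kn r i X π → (∀ x ∈ X, ∀ u ∈ x, I t u) →
      ∀ φ ∈ ({.ent r π i X} : Set (SFact n V)), (assertions L v₀ Kn I).OK (t + 1) φ ∧
        ∀ p, (assertions L v₀ Kn I).own φ p → p = i := by
    rintro π X t hrec hX _ rfl
    refine ⟨⟨fun x hx u hu => hI _ _ _ (Nat.le_succ t) (hX x hx u hu), hrec⟩, ?_⟩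
    rintro p ⟨r', X', h⟩
    cases h; rfl
  have hown : ∀ {π X} {K K₁ : Set (SFact n V)}, (∀ r' X', .ent r' [] i X' ∈ K → r' ≤ r) →
      (∀ φ ∈ K₁, (assertions L v₀ Kn I).own φ i → φ ∈ K ∪ {.ent r π i X}) →
      ∀ r' X', .ent r' [] i X' ∈ K₁ → r' ≤ r := by
    intro π X K K₁ hK h r' X' hX'
    rcases h _ hX' ⟨r', X', rfl⟩ with h | h
    · exact hK r' X' h
    · cases h; exact le_rfl
  induction l with
  | zero =>
    intro π X t K hπ hrec hU hX hK ht hKn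
    refine ⟨hadd (hrec hKn) hX, fun e K₁ he hE _ hsub hok ho => ?_⟩
    refine hκ X π e K₁ hπ ⟨t + 1, i, ?_⟩ hU (fun x hx u hu => hI _ _ _ he.le (hX x hx u hu))
      (hown hK ho) (ht.trans he)
    change Kn (t + 1) i = _ at hKn
    rw [hKn]; exact .inr rfl
  | succ l ih =>
    intro π X t K hπ hrec hU hX hK ht hKn
    refine ⟨hadd (hrec hKn) hX, fun e₁ K₁ he₁ hE₁ _ hsub₁ hok₁ ho₁ => ?_⟩
    change Exchange Kn _ _ _ _ at hE₁
    change Kn (t + 1) i = _ at hKn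
    have hent : SFact.ent r π i X ∈ K ∪ {.ent r π i X} := .inr rfl
    have hent₁ := hE₁.subset hent
    have hknown : Known Kn (.ent r π i X) := ⟨t + 1, i, by rw [hKn]; exact hent⟩
    have hK₁ := hown hK ho₁
    intro _
    refine ⟨fun φ hφ => absurd hφ (Set.notMem_empty φ), fun e₂ K₂ he₂ hE₂ _ hsub₂ hok₂ ho₂ => ?_⟩
    change Exchange Kn _ _ _ _ at hE₂
    rw [Set.union_empty] at hE₂ ho₂
    have hent₂ := hE₂.subset hent₁
    have hK₂ : ∀ r' X', .ent r' [] i X' ∈ K₂ → r' ≤ r := fun r' X' h =>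
      hK₁ r' X' (ho₂ _ h ⟨r', X', rfl⟩)
    by_cases hcard : (acc K₂ r π).ncard ≤ mid L π
    · beta_reduce
      rw [if_pos hcard]
      refine ih (false :: π) X e₂ K₂ (by rw [List.length_cons]; omega) (fun _ => ?_) hU
        (fun x hx u hu => hI _ _ _ (he₁.trans he₂).le (hX x hx u hu)) hK₂ ((ht.trans he₁).trans he₂)
      -- `hE₁` is the announcing exchange and `hE₂` the counting one, which starts at `e₁ + 1`.
      exact ⟨hknown, _, _, _, _, _, _, _, _, hE₁, hE₂, Nat.le_succ e₁, hent, hent₁,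
        ⟨e₂ + 1, i, hsub₂⟩, hcard⟩
    · beta_reduce
      rw [if_neg hcard]
      intro _
      refine ⟨fun φ hφ => absurd hφ (Set.notMem_empty φ), fun e₃ K₃ he₃ hE₃ _ hsub₃ hok₃ ho₃ => ?_⟩
      change Exchange Kn _ _ _ _ at hE₃
      rw [Set.union_empty] at hE₃ ho₃
      have hent₃ := hE₃.subset hent₂
      have hK₃ : ∀ r' X', .ent r' [] i X' ∈ K₃ → r' ≤ r := fun r' X' h =>
        hK₂ r' X' (ho₃ _ h ⟨r', X', rfl⟩)
      refine ih (true :: π) (acc K₃ r π) e₃ K₃ (by rw [List.length_cons]; omega) (fun _ => ?_) ?_ ?_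
        hK₃ (((ht.trans he₁).trans he₂).trans he₃)
      · exact ⟨_, _, _, _, hE₃, rfl, ⟨e₃ + 1, i, hsub₃⟩, not_le.1 hcard, X, hent₂⟩
      · exact hU.trans (Set.sUnion_subset_sUnion fun x hx => ⟨i, X, hent₃, hx⟩)
      · rintro x ⟨p, Y, hY, hx⟩
        exact (hok₃ _ hY).1 x hx

/-- A successful attempt outputs a superset of its own input, which contains the base. A failed one
raises `dn` by at least one, so the sum of `dn` and the remaining attempts does not decrease. -/
theorem wp_attempt {i : Fin n} {a : ℕ} {x : SnapOp V} {t₁ : ℕ}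
    (hbase : KnownBefore Kn (base Kn a i) t₁) (m : ℕ) : ∀ (t : ℕ) (K : Set (SFact n V)),
      t₁ + 1 ≤ dn K + m → base Kn a i ⊆ pool K → (∀ φ ∈ K, OK L Kn I t φ) →
      (assertions L v₀ Kn I).Idle i K →
      (assertions L v₀ Kn I).wp i a x (attempt L i (resp v₀ x) m K) t K := by
  classical
  induction m with
  | zero =>
    intro t K ht hB hok hidle hKn
    change Kn (t + 1) i = _ at hKn
    refine ⟨fun φ hφ => absurd hφ (Set.notMem_empty φ), by rwa [Set.union_empty], ?_⟩
    -- With no attempt left, `t₁ < dn K`, so a late enough round is known and `latest` is not the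
    -- default.
    have hex : ∃ w, SFact.fin (dn K) w ∈ K := dn_mem (by omega)
    refine ⟨dn K, latest K, ?_, rfl, .inr ⟨t₁, hbase, by omega⟩⟩
    rw [hKn, latest, dif_pos hex]
    exact .inl hex.choose_spec
  | succ m ih =>
    intro t K ht hB hok hidle hKn
    refine ⟨fun φ hφ => absurd hφ (Set.notMem_empty φ), fun e₁ K₁ he₁ hE₁ hle₁ hsub₁ hok₁ ho₁ => ?_⟩
    change Exchange Kn _ _ _ _ at hE₁
    change Kn e₁ i ⊆ K₁ at hle₁
    rw [Set.union_empty] at hE₁ ho₁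
    -- Earlier root entries of this node belong to completed rounds, so round `dn K + 1` is entered
    -- for the first time.
    have hownK : ∀ r X, .ent r [] i X ∈ K₁ → r < dn K + 1 := by
      intro r X h
      obtain ⟨r', w, hr, hw⟩ := hidle r X (ho₁ _ h ⟨r, X, rfl⟩)
      exact Nat.lt_succ_of_le (hr.trans (le_dn_of_OK hok hw))
    refine wp_agree hI (U := base Kn a i) (t₀ := t) ?_ L [] {pool K₁} e₁ K₁ (by simp) ?_ ?_ ?_
      (fun r' X' h => (hownK r' X' h).le) he₁
    · intro X π t₂ K₂ hπ hent hU hX hK₂ htt _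
      refine ⟨?_, fun e₃ K₃ he₃ hE₃ _ hsub₃ hok₃ ho₃ => ?_⟩
      · rintro _ ⟨u, ⟨x, hx, hu⟩, rfl⟩
        refine ⟨hI _ _ _ (Nat.le_succ t₂) (hX x hx u hu), ?_⟩
        rintro p ⟨r', X', h⟩
        cases h
      change Exchange Kn _ _ _ _ at hE₃
      have hUp : Set.sUnion X ⊆ pool (K₂ ∪ SFact.upd '' Set.sUnion X) :=
        fun u hu => .inr ⟨u, hu, rfl⟩
      have hown₃ : ∀ r' X', .ent r' [] i X' ∈ K₃ → r' ≤ dn K + 1 := by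
        intro r' X' h
        rcases ho₃ _ h ⟨r', X', rfl⟩ with h | ⟨u, -, h⟩
        · exact hK₂ r' X' h
        · cases h
      have hdn := dn_le_of_OK hok
      by_cases hlt : dn K₃ < dn K + 1
      · beta_reduce
        rw [if_pos hlt]
        intro hKn₃
        change Kn (e₃ + 1) i = _ at hKn₃
        refine ⟨?_, ?_, ?_⟩
        · rintro _ rfl
          refine ⟨⟨by omega, by omega, ?_, ⟨π, i, X, hπ, rfl, hent⟩, _, _, _, _, Nat.le_succ e₃, hE₃,
            hUp, fun r' w' h => (le_dn_of_OK hok₃ h).trans_lt hlt⟩, ?_⟩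
          · rintro u ⟨x, hx, hu⟩
            exact hI _ _ _ (by omega) (hX x hx u hu)
          · rintro p ⟨r', X', h⟩
            cases h
        · intro r' X' h
          rcases h with h | h
          · exact ⟨_, _, hown₃ r' X' h, .inr rfl⟩
          · cases h
        · exact ⟨_, _, by rw [hKn₃]; exact .inr rfl, rfl, .inl hU⟩
      · beta_reduce
        rw [if_neg hlt]
        refine ih e₃ K₃ (by omega) (hU.trans (hUp.trans (pool_mono hE₃.subset))) hok₃ ?_
        intro r' X' h
        obtain ⟨w, hw⟩ := dn_mem (K := K₃) (by omega)
        exact ⟨_, w, (hown₃ r' X' h).trans (not_lt.1 hlt), hw⟩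
    · intro hKn₁
      refine ⟨⟨_, _, _, _, hE₁, rfl, ?_⟩, e₁, ?_, ?_, ?_⟩
      · by_cases h0 : dn K = 0
        · exact .inl (by rw [h0])
        · obtain ⟨w, hw⟩ := dn_mem h0
          exact .inr ⟨_, w, rfl, hw⟩
      · intro X' h
        exact lt_irrefl _ (hownK _ X' (hle₁ h))
      · rw [hKn₁]; exact .inr rfl
      · intro X' h
        rw [hKn₁] at h
        rcases h with h | h
        · exact absurd (hownK _ X' h) (lt_irrefl _)
        · cases h; rfl
    · intro u hu
      exact ⟨_, rfl, pool_mono hE₁.subset (hB hu)⟩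
    · rintro x rfl u hu
      exact hok₁ _ hu

/-- The first exchange gathers the base, the second makes a majority know it and bounds the
completed rounds seen meanwhile by `dn K₁`. Then `t₁ = dn K₁ + 1`, and two attempts are just enough
to pass it. -/
theorem wp_snapProg (hmono : ∀ j, Monotone fun k => Kn k j) {i : Fin n} {a c : ℕ} {x : SnapOp V}
    (hc : ∀ v, x = .update v → I (a + 1) (i, c, v))
    (hidle : (assertions L v₀ Kn I).Idle i (Kn a i))
    (hok : ∀ q, ∀ φ ∈ Kn a q, OK L Kn I a φ) :
    (assertions L v₀ Kn I).wp i a x (snapProg L v₀ i c x) a (Kn a i) := by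
  intro hKn
  change Kn (a + 1) i = _ at hKn
  have hfacts : ∀ φ ∈ opFacts i c x, ∃ v, x = .update v ∧ φ = .upd (i, c, v) := by
    intro φ hφ
    cases x with
    | update v => exact ⟨v, rfl, hφ⟩
    | scan => exact absurd hφ (Set.notMem_empty φ)
  refine ⟨?_, fun e₀ K₀ he₀ hE₀ _ _ hok₀ ho₀ => ?_⟩
  · intro φ hφ
    obtain ⟨v, hv, rfl⟩ := hfacts φ hφ
    refine ⟨hc v hv, ?_⟩
    rintro p ⟨r', X', h⟩
    cases h
  change Exchange Kn _ _ _ _ at hE₀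
  -- Outputs recorded before event `a` had been spread to majorities by then, so the first exchange
  -- meets them.
  have hB : base Kn a i ⊆ pool K₀ := by
    rintro u (⟨q, r, w, hw, hu⟩ | hu)
    · obtain ⟨-, -, -, -, s, e, Ks, Ke, he, hE, hwK, -⟩ := hok q _ hw
      exact hE.of_le hmono hE₀ (he.trans (Nat.le_succ a)) (hwK hu)
    · rw [hKn] at hu
      exact hE₀.subset hu
  intro _
  refine ⟨fun φ hφ => absurd hφ (Set.notMem_empty φ), fun e₁ K₁ he₁ hE₁ _ _ hok₁ ho₁ => ?_⟩
  change Exchange Kn _ _ _ _ at hE₁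
  rw [Set.union_empty] at hE₁ ho₁
  refine wp_attempt hI (t₁ := dn K₁ + 1) ⟨by omega, _, _, _, _, hE₁, hB, fun r w h =>
    Nat.lt_succ_of_le (le_dn_of_OK hok₁ h)⟩ 2 e₁ K₁ (by omega) (hB.trans (pool_mono hE₁.subset))
    hok₁ ?_
  intro r X h
  rcases ho₀ _ (ho₁ _ h ⟨r, X, rfl⟩) ⟨r, X, rfl⟩ with h | h
  · obtain ⟨r', w, hr, hw⟩ := hidle r X h
    exact ⟨r', w, hr, hE₁.subset (hE₀.subset (.inl hw))⟩
  · obtain ⟨v, -, h⟩ := hfacts _ h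
    cases h

end Correct

end Snap

/-! ### From a chain of views to a linearization. -/

namespace Protocol

variable {n : ℕ} {V : Type u} {P : Protocol n (SnapOp V) (SnapResp n V)} {f : ℕ}
  {ev : ℕ → Event n (SnapOp V)}

/-- The operation `a` completes. -/
def Completed (P : Protocol n (SnapOp V) (SnapResp n V)) (ev : ℕ → Event n (SnapOp V)) (a : ℕ) :
    Prop :=
  ∃ i x b r, P.Completes ev a i x b r

/-- The operation `a` is an update. -/
def IsUpdate (ev : ℕ → Event n (SnapOp V)) (a : ℕ) : Prop :=
  ∃ i v, Invokes ev a i (.update v)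

/-- The completed operations `c` before which (or as which) the operation `a` is linearized, if `W c`
is the set of updates in the view of `c`. -/
def above (P : Protocol n (SnapOp V) (SnapResp n V)) (ev : ℕ → Event n (SnapOp V))
    (W : ℕ → Set ℕ) (a : ℕ) : Set ℕ :=
  {c | Completed P ev c ∧
    ((IsUpdate ev a ∧ a ∈ W c) ∨ (¬ IsUpdate ev a ∧ Completed P ev a ∧ W a ⊆ W c))}

/-- The linearization order given by the views `W`. -/
def viewLT (P : Protocol n (SnapOp V) (SnapResp n V)) (ev : ℕ → Event n (SnapOp V))
    (W : ℕ → Set ℕ) (a a' : ℕ) : Prop :=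
  above P ev W a' ⊂ above P ev W a ∨ (above P ev W a' = above P ev W a ∧
    ((IsUpdate ev a ∧ ¬ IsUpdate ev a') ∨ ((IsUpdate ev a ↔ IsUpdate ev a') ∧ a < a')))

theorem viewLT.subset {W : ℕ → Set ℕ} {a a' : ℕ} (h : viewLT P ev W a a') :
    above P ev W a' ⊆ above P ev W a := by
  rcases h with h | ⟨h, -⟩
  · exact h.subset
  · exact h.subset

/-- Views of the completed operations that are comparable and respect real time give a
linearization. -/
theorem isLinearization_viewLT (hex : P.IsExecution f ev) {v₀ : Fin n → V} {W : ℕ → Set ℕ}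
    (chain : ∀ a a', Completed P ev a → Completed P ev a' → W a ⊆ W a' ∨ W a' ⊆ W a)
    (self : ∀ a, Completed P ev a → IsUpdate ev a → a ∈ W a)
    (real : ∀ a i x b r a', P.Completes ev a i x b r → Completed P ev a' → b < a' → W a ⊆ W a')
    (past : ∀ a i x b r, P.Completes ev a i x b r → ∀ u ∈ W a, u ≤ b)
    (scan : ∀ a i b snap, P.Completes ev a i .scan b (.view snap) → ∀ j,
      (∃ u ∈ W a, Invokes ev u j (.update (snap j)) ∧
        ∀ u' ∈ W a, ∀ v, Invokes ev u' j (.update v) → u' ≤ u) ∨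
      ((∀ u ∈ W a, ∀ v, ¬ Invokes ev u j (.update v)) ∧ snap j = v₀ j)) :
    P.IsLinearization v₀ ev (viewLT P ev W) := by
  have up : ∀ {a c c'}, c ∈ above P ev W a → Completed P ev c' → W c ⊆ W c' →
      c' ∈ above P ev W a := by
    rintro a c c' ⟨-, ⟨h1, h2⟩ | ⟨h1, h2, h3⟩⟩ hc' hsub
    · exact ⟨hc', .inl ⟨h1, hsub h2⟩⟩
    · exact ⟨hc', .inr ⟨h1, h2, h3.trans hsub⟩⟩
  -- Each `above` set is upward closed in the chain of views, so any two are comparable; a larger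
  -- one means an earlier place in the order.
  have tot : ∀ a a', above P ev W a ⊆ above P ev W a' ∨ above P ev W a' ⊆ above P ev W a := by
    intro a a'
    by_contra hcon
    push Not at hcon
    obtain ⟨⟨c, hc, hc'⟩, ⟨d, hd, hd'⟩⟩ := And.imp Set.not_subset.1 Set.not_subset.1 hcon
    rcases chain c d hc.1 hd.1 with h | h
    · exact hd' (up hc hd.1 h)
    · exact hc' (up hd hc.1 h)
  have mem_self : ∀ a, Completed P ev a → a ∈ above P ev W a := by
    intro a ha
    by_cases hu : IsUpdate ev a
    · exact ⟨ha, .inl ⟨hu, self a ha hu⟩⟩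
    · exact ⟨ha, .inr ⟨hu, ha, subset_rfl⟩⟩
  have mem_update : ∀ {u c}, IsUpdate ev u → c ∈ above P ev W u → u ∈ W c := by
    rintro u c hu ⟨-, ⟨-, h⟩ | ⟨h, -⟩⟩
    · exact h
    · exact absurd hu h
  have scan_not : ∀ {a i}, Invokes ev a i .scan → ¬ IsUpdate ev a := by
    rintro a i h ⟨j, v, h'⟩
    cases (h.unique h').2
  have of_subset : ∀ {a a'}, above P ev W a' ⊆ above P ev W a →
      ((IsUpdate ev a ∧ ¬ IsUpdate ev a') ∨ ((IsUpdate ev a ↔ IsUpdate ev a') ∧ a < a')) →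
      viewLT P ev W a a' := by
    intro a a' h h'
    rcases h.ssubset_or_eq with h | h
    · exact .inl h
    · exact .inr ⟨h, h'⟩
  refine ⟨?_, ?_, ?_, ?_, ?_⟩
  · rintro a i x - (h | ⟨-, ⟨h1, h2⟩ | ⟨-, h⟩⟩)
    · exact h.ne rfl
    · exact h2 h1
    · exact lt_irrefl _ h
  · rintro a i x a' i' x' a'' i'' x'' - - - (h | ⟨h, hh⟩) (h' | ⟨h', hh'⟩)
    · exact .inl (h'.trans h)
    · exact .inl (h' ▸ h)
    · exact .inl (h ▸ h')
    · refine .inr ⟨h'.trans h, ?_⟩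
      rcases hh with ⟨h1, h2⟩ | ⟨h1, h2⟩ <;> rcases hh' with ⟨h3, h4⟩ | ⟨h3, h4⟩
      · exact absurd h3 h2
      · exact .inl ⟨h1, fun h => h2 (h3.2 h)⟩
      · exact .inl ⟨h1.2 h3, h4⟩
      · exact .inr ⟨h1.trans h3, h2.trans h4⟩
  · intro a i x a' i' x' _ _ hne
    by_cases he : above P ev W a' = above P ev W a
    · by_cases hu : IsUpdate ev a <;> by_cases hu' : IsUpdate ev a'
      · rcases lt_or_gt_of_ne hne with h | h
        · exact .inl (.inr ⟨he, .inr ⟨⟨fun _ => hu', fun _ => hu⟩, h⟩⟩)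
        · exact .inr (.inr ⟨he.symm, .inr ⟨⟨fun _ => hu, fun _ => hu'⟩, h⟩⟩)
      · exact .inl (.inr ⟨he, .inl ⟨hu, hu'⟩⟩)
      · exact .inr (.inr ⟨he.symm, .inl ⟨hu', hu⟩⟩)
      · rcases lt_or_gt_of_ne hne with h | h
        · exact .inl (.inr ⟨he, .inr ⟨⟨fun h => absurd h hu, fun h => absurd h hu'⟩, h⟩⟩)
        · exact .inr (.inr ⟨he.symm, .inr ⟨⟨fun h => absurd h hu', fun h => absurd h hu⟩, h⟩⟩)
    · rcases tot a a' with h | h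
      · exact .inr (.inl (h.ssubset_of_ne fun h => he h.symm))
      · exact .inl (.inl (h.ssubset_of_ne he))
  · intro a i x b r a' i' x' hc ha' hb
    have hca : Completed P ev a := ⟨i, x, b, r, hc⟩
    -- An update `a'` in a view inside `W a` would have been invoked by event `b`, against `b < a'`.
    have hsub : above P ev W a' ⊆ above P ev W a := by
      rintro c ⟨hcc, ⟨h1, h2⟩ | ⟨h1, h2, h3⟩⟩
      · rcases chain a c hca hcc with h | h
        · exact up (mem_self a hca) hcc h
        · have := past a i x b r hc a' (h h2)
          omega
      · exact up (mem_self a hca) hcc ((real a i x b r a' hc h2 hb).trans h3)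
    by_cases hmem : a ∈ above P ev W a'
    swap
    · exact .inl ⟨hsub, fun h => hmem (h (mem_self a hca))⟩
    rcases hmem with ⟨-, ⟨h1, h2⟩ | ⟨h1, -, -⟩⟩
    · have := past a i x b r hc a' h2
      omega
    · refine of_subset hsub ?_
      by_cases hu : IsUpdate ev a
      · exact .inl ⟨hu, h1⟩
      · exact .inr ⟨⟨fun h => absurd h hu, fun h => absurd h h1⟩, hc.2.1.trans_lt hb⟩
  · intro a i b snap hc j
    have hca : Completed P ev a := ⟨i, _, b, _, hc⟩
    have hscan := scan_not hc.1
    have hmem : ∀ {u}, IsUpdate ev u → viewLT P ev W u a → u ∈ W a := fun hu hlt =>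
      mem_update hu (hlt.subset (mem_self a hca))
    rcases scan a i b snap hc j with ⟨u, hu, hinv, hmax⟩ | ⟨hno, hv⟩
    · left
      refine ⟨u, hinv, of_subset ?_ (.inl ⟨⟨j, _, hinv⟩, hscan⟩), ?_⟩
      · rintro c ⟨hcc, ⟨h1, -⟩ | ⟨-, -, h3⟩⟩
        · exact absurd h1 hscan
        · exact ⟨hcc, .inl ⟨⟨j, _, hinv⟩, h3 hu⟩⟩
      · intro u' w hinv' hlt hne
        have hu' : IsUpdate ev u' := ⟨j, w, hinv'⟩
        have hle := hmax u' (hmem hu' hlt) w hinv'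
        have hltu : u' < u := lt_of_le_of_ne hle hne
        -- The earlier update `u'` completes before `u` starts, so its view lacks `u`. Views with
        -- `u` therefore include the view of `u'`, and with it `u'` itself.
        obtain ⟨b', r', hc', hb'⟩ := exists_completes_of_invokes hex hinv' hinv hltu
        have hcu' : Completed P ev u' := ⟨_, _, _, _, hc'⟩
        refine of_subset ?_ (.inr ⟨⟨fun _ => ⟨j, _, hinv⟩, fun _ => hu'⟩, hltu⟩)
        intro c hcu
        have huc := mem_update ⟨j, _, hinv⟩ hcu
        rcases chain c u' hcu.1 hcu' with h | h
        · have := past _ _ _ _ _ hc' u (h huc)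
          omega
        · exact ⟨hcu.1, .inl ⟨hu', h (self u' hcu' hu')⟩⟩
    · right
      refine ⟨fun u w hinv hlt => ?_, hv⟩
      exact hno u (hmem ⟨j, w, hinv⟩ hlt) w hinv

end Protocol

/-! ### Atomicity of the snapshot protocol. -/

namespace Snap

open Protocol XProtocol

variable {n : ℕ} {V : Type u} {f : ℕ} {L : ℕ} {v₀ : Fin n → V} {ev : ℕ → Event n (SnapOp V)}

/-- The number of operations of node `j` before event `k`. -/
noncomputable abbrev opCount (L : ℕ) (v₀ : Fin n → V) (ev : ℕ → Event n (SnapOp V)) (k : ℕ)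
    (j : Fin n) : ℕ :=
  (st (snapProg L v₀) ev k j).cnt

/-- The update `u` is invoked before event `k`. -/
def Invoked (L : ℕ) (v₀ : Fin n → V) (ev : ℕ → Event n (SnapOp V)) (k : ℕ) (u : Upd n V) : Prop :=
  ∃ a, a < k ∧ Invokes ev a u.1 (.update u.2.2) ∧ opCount L v₀ ev a u.1 = u.2.1

theorem run_cnt {F Out : Type u} (s : XState n F Out) (p : Prog F Out) :
    (s.run p).state.cnt = s.cnt := by
  cases p <;> rfl

theorem opCount_succ {a : ℕ} {i : Fin n} {x : SnapOp V} (h : Invokes ev a i x) :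
    opCount L v₀ ev (a + 1) i = opCount L v₀ ev a i + 1 := by
  obtain ⟨cut, h⟩ := h
  have := state_of_handles (Handles.invoke (P := xchProtocol (snapProg L v₀)) x cut h)
  simp only [opCount, st]
  rw [this]
  exact run_cnt _ _

theorem opCount_mono (i : Fin n) : Monotone fun k => opCount L v₀ ev k i := by
  refine monotone_nat_of_le_succ fun k => ?_
  rcases node_step (prog := snapProg L v₀) (ev := ev) k i with hq | ⟨x, -, hr⟩ |
    ⟨j, t, m, c, -, -, -, -, -, hr⟩
  · exact hq.cnt.ge
  · simp only [opCount]; rw [hr.state, run_cnt]; exact Nat.le_succ _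
  · simp only [opCount]; rw [hr.state, run_cnt]; exact le_rfl

theorem opCount_lt {a a' : ℕ} {i : Fin n} {x : SnapOp V} (h : Invokes ev a i x) (ha : a < a') :
    opCount L v₀ ev a i < opCount L v₀ ev a' i := by
  have h1 := opCount_succ (L := L) (v₀ := v₀) h
  have h2 : opCount L v₀ ev (a + 1) i ≤ opCount L v₀ ev a' i := opCount_mono i ha
  omega

/-- Node and operation number identify an invocation; this translates between sets of `Upd` and sets
of event indices. -/
theorem opCount_inj {a a' : ℕ} {i : Fin n} {x x' : SnapOp V} (h : Invokes ev a i x)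
    (h' : Invokes ev a' i x') (he : opCount L v₀ ev a i = opCount L v₀ ev a' i) : a = a' := by
  rcases lt_trichotomy a a' with hlt | heq | hlt
  · exact absurd he (opCount_lt h hlt).ne
  · exact heq
  · exact absurd he (opCount_lt h' hlt).ne'

theorem sound_snapProg (hex : (xchProtocol (snapProg L v₀)).IsExecution f ev) :
    (∀ k i, ∀ φ ∈ knowAt (snapProg L v₀) ev k i,
      OK L (knowAt (snapProg L v₀) ev) (Invoked L v₀ ev) k φ) ∧
    ∀ b i o, (xchProtocol (snapProg L v₀)).Returns ev b i o →
      ∃ a x, (xchProtocol (snapProg L v₀)).Completes ev a i x b o ∧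
        (assertions L v₀ (knowAt (snapProg L v₀) ev) (Invoked L v₀ ev)).Post i a x b o := by
  have hI : ∀ k k' u, k ≤ k' → Invoked L v₀ ev k u → Invoked L v₀ ev k' u :=
    fun k k' u hk ⟨a, ha, h⟩ => ⟨a, ha.trans_le hk, h⟩
  refine sound (S := assertions L v₀ (knowAt (snapProg L v₀) ev) (Invoked L v₀ ev)) hex rfl
    (fun k φ h => OK.mono hI (Nat.le_succ k) h) (fun i r X h => absurd h (Set.notMem_empty _)) ?_ ?_
  · intro i K K' h hsub ho r X hX
    obtain ⟨r', w, hr, hw⟩ := h r X (ho _ hX ⟨r, X, rfl⟩)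
    exact ⟨r', w, hr, hsub hw⟩
  · intro i a x hx hidle hok
    refine wp_snapProg hI know_mono ?_ hidle hok
    rintro v rfl
    exact ⟨a, Nat.lt_succ_self a, hx, rfl⟩

theorem own_update_mem {a : ℕ} {i : Fin n} {v : V} (h : Invokes ev a i (.update v)) :
    SFact.upd (i, opCount L v₀ ev a i, v) ∈ knowAt (snapProg L v₀) ev (a + 1) i := by
  obtain ⟨cut, h⟩ := h
  have := state_of_handles (Handles.invoke (P := xchProtocol (snapProg L v₀)) _ cut h)
  simp only [knowAt, st]
  rw [this]
  exact .inr rfl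

/-- The view of a completed operation. -/
theorem exists_view (hex : (xchProtocol (snapProg L v₀)).IsExecution f ev) {a b : ℕ} {i : Fin n}
    {x : SnapOp V} {o : SnapResp n V} (hc : (xchProtocol (snapProg L v₀)).Completes ev a i x b o) :
    ∃ r w, SFact.fin r w ∈ knowAt (snapProg L v₀) ev (b + 1) i ∧ o = resp v₀ x w ∧
      base (knowAt (snapProg L v₀) ev) a i ⊆ w := by
  obtain ⟨hOK, hret⟩ := sound_snapProg hex
  obtain ⟨a', x', hc', r, w, hw, ho, hB⟩ := hret b i o hc.2.2.1
  obtain rfl := hc.inv_unique hex hc'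
  obtain ⟨-, rfl⟩ := hc.1.unique hc'.1
  refine ⟨r, w, hw, ho, ?_⟩
  rcases hB with hB | ⟨t, ⟨ht, s, e, Ks, Ke, hE, hU, hfin⟩, htr⟩
  · exact hB
  -- An adopted output comes from a round beyond the one before whose completion a majority knew the
  -- base.
  · exact subset_fin hOK know_mono hE hU hfin ht htr ⟨_, _, hw⟩

theorem linearizable (hL : n ≤ 2 ^ L) (hex : (xchProtocol (snapProg L v₀)).IsExecution f ev) :
    ∃ lt, (xchProtocol (snapProg L v₀)).IsLinearization v₀ ev lt := by
  classical
  have hOK := (sound_snapProg hex).1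
  have hview : ∀ a, ∃ w, ∀ i x b o, (xchProtocol (snapProg L v₀)).Completes ev a i x b o →
      (∃ r, SFact.fin r w ∈ knowAt (snapProg L v₀) ev (b + 1) i) ∧ o = resp v₀ x w ∧
        base (knowAt (snapProg L v₀) ev) a i ⊆ w := by
    intro a
    by_cases h : Completed (xchProtocol (snapProg L v₀)) ev a
    · obtain ⟨i, x, b, o, hc⟩ := h
      obtain ⟨r, w, h1, h2⟩ := exists_view hex hc
      refine ⟨w, fun i' x' b' o' hc' => ?_⟩
      obtain ⟨rfl, rfl, rfl, rfl⟩ := hc.out_unique hc'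
      exact ⟨⟨r, h1⟩, h2⟩
    · exact ⟨∅, fun i x b o hc => absurd ⟨i, x, b, o, hc⟩ h⟩
  choose w hw using hview
  have hinv : ∀ {a i x b o}, (xchProtocol (snapProg L v₀)).Completes ev a i x b o →
      ∀ u ∈ w a, Invoked L v₀ ev (b + 1) u := by
    intro a i x b o hc u hu
    obtain ⟨⟨r, hr⟩, -⟩ := hw a i x b o hc
    exact (hOK _ _ _ hr).2.2.1 u hu
  let W : ℕ → Set ℕ := fun a =>
    {u | ∃ j v, Invokes ev u j (.update v) ∧ (j, opCount L v₀ ev u j, v) ∈ w a}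
  have hWsub : ∀ {a a'}, w a ⊆ w a' → W a ⊆ W a' := fun h u ⟨j, v, h1, h2⟩ => ⟨j, v, h1, h h2⟩
  refine ⟨_, isLinearization_viewLT hex (W := W) ?_ ?_ ?_ ?_ ?_⟩
  · rintro a a' ⟨i, x, b, o, hc⟩ ⟨i', x', b', o', hc'⟩
    obtain ⟨⟨r, hr⟩, -⟩ := hw a i x b o hc
    obtain ⟨⟨r', hr'⟩, -⟩ := hw a' i' x' b' o' hc'
    exact (fin_comparable hOK know_mono hL ⟨_, _, hr⟩ ⟨_, _, hr'⟩).imp hWsub hWsub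
  · rintro a ⟨i, x, b, o, hc⟩ ⟨j, v, hu⟩
    obtain ⟨rfl, rfl⟩ := hc.1.unique hu
    exact ⟨i, v, hu, (hw a i _ b o hc).2.2 (.inr (own_update_mem hu))⟩
  · rintro a i x b o a' hc ⟨i', x', b', o', hc'⟩ hlt
    obtain ⟨⟨r, hr⟩, -⟩ := hw a i x b o hc
    refine hWsub fun u hu => (hw a' i' x' b' o' hc').2.2 (.inl ⟨i, r, w a, ?_, hu⟩)
    exact know_mono i hlt hr
  · rintro a i x b o hc u ⟨j, v, hu, hmem⟩
    obtain ⟨a₀, ha₀, h1, h2⟩ := hinv hc _ hmem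
    have := opCount_inj h1 hu h2
    omega
  · intro a i b snap hc j
    obtain ⟨-, hsnap, -⟩ := hw a i _ b _ hc
    have hsnap : snap = lastVal v₀ (w a) := by
      simpa [resp] using hsnap
    by_cases h : ∃ v s, (j, s, v) ∈ w a ∧ ∀ s' v', (j, s', v') ∈ w a → s' ≤ s
    · left
      have hj : snap j = h.choose := by rw [hsnap, lastVal, dif_pos h]
      obtain ⟨s, hs, hmax⟩ := h.choose_spec
      rw [← hj] at hs
      obtain ⟨u, -, hu, hcu⟩ := hinv hc _ hs
      change opCount L v₀ ev u j = s at hcu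
      refine ⟨u, ⟨j, _, hu, by rwa [hcu]⟩, hu, ?_⟩
      rintro u' ⟨j', v', hu', hmem⟩ v hv
      obtain ⟨rfl, -⟩ := hv.unique hu'
      have h1 := hmax _ _ hmem
      by_contra hlt
      have : opCount L v₀ ev u j < opCount L v₀ ev u' j := opCount_lt hu (not_le.1 hlt)
      omega
    · right
      refine ⟨?_, by rw [hsnap, lastVal, dif_neg h]⟩
      rintro u ⟨j', v', hu', hmem⟩ v hv
      obtain ⟨rfl, -⟩ := hv.unique hu'
      apply h
      -- Operation numbers in a view are bounded by the count at its completion, so a maximal one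
      -- exists as soon as node `j` has any update in it.
      have hbdd : BddAbove {s | ∃ v, (j, s, v) ∈ w a} := by
        refine ⟨opCount L v₀ ev (b + 1) j, ?_⟩
        rintro s ⟨v, hs⟩
        obtain ⟨a₀, ha₀, -, h2⟩ := hinv hc _ hs
        change opCount L v₀ ev a₀ j = s at h2
        rw [← h2]
        exact opCount_mono j ha₀.le
      obtain ⟨v, hv⟩ := Nat.sSup_mem (s := {s | ∃ v, (j, s, v) ∈ w a}) ⟨_, v', hmem⟩ hbdd
      exact ⟨v, _, hv, fun s' v' h' => le_csSup hbdd ⟨v', h'⟩⟩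

theorem isAtomicSnapshot (hL : n ≤ 2 ^ L) (hf : 2 * f < n) :
    (xchProtocol (snapProg L v₀)).IsAtomicSnapshot f v₀ where
  wellFormed ev hex b i o h := by
    obtain ⟨a, x, hc, r, w, -, ho, -⟩ := (sound_snapProg hex).2 b i o h
    refine ⟨a, x, hc, ?_⟩
    rw [ho]
    cases x <;> trivial
  linearizable ev hex := linearizable hL hex
  terminates := (completesWithin hf fun i c x => depth_snapProg L v₀ i c x).terminates

end Snap

/-! ### The logarithmic bound and conclusion. -/

theorem clog_isBigO_log :
    (fun n : ℕ => (2 : ℝ) * ((6 * Nat.clog 2 n + 8 : ℕ) : ℝ)) =O[atTop]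
      fun n : ℕ => Real.log (n : ℝ) := by
  -- With `clog 2 n ≤ log n / log 2 + 1`, the value `12 * clog 2 n + 16` is at most `12 * log n /
  -- log 2 + 28`, and `1 ≤ log n` for `n ≥ 3`.
  refine IsBigO.of_bound (12 / Real.log 2 + 28) ?_
  filter_upwards [eventually_ge_atTop 3] with n hn
  have h2 : 0 < Real.log 2 := Real.log_pos one_lt_two
  have hn' : (3 : ℝ) ≤ n := by exact_mod_cast hn
  have hlog : 1 ≤ Real.log n := by
    rw [Real.le_log_iff_exp_le (by linarith)]
    exact (Real.exp_one_lt_d9.le.trans (by norm_num)).trans hn'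
  have hclog : (Nat.clog 2 n : ℝ) ≤ Real.log n / Real.log 2 + 1 := by
    rw [← Real.natCeil_logb_natCast]
    refine (Nat.ceil_lt_add_one (Real.logb_nonneg (by norm_num) (by linarith))).le.trans ?_
    rw [Real.logb, Nat.cast_ofNat]
  rw [Real.norm_of_nonneg (by positivity), Real.norm_of_nonneg (by linarith)]
  push_cast
  have : 12 / Real.log 2 * Real.log n = 12 * (Real.log n / Real.log 2) := by ring
  rw [add_mul, this]
  linarith

theorem mainTheorem5 :
    ∃ T : ℕ → ℝ, (T =O[atTop] fun n : ℕ => Real.log (n : ℝ)) ∧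
      ∀ n f : ℕ, 2 * f < n → ∀ (V : Type u) (v₀ : Fin n → V),
        ∃ P : Protocol n (SnapOp V) (SnapResp n V),
          P.IsAtomicSnapshot f v₀ ∧ P.CompletesWithin f (T n) := by
  refine ⟨_, clog_isBigO_log, fun n f hf V v₀ =>
    ⟨xchProtocol (Snap.snapProg (Nat.clog 2 n) v₀), ?_, ?_⟩⟩
  · exact Snap.isAtomicSnapshot (Nat.le_pow_clog one_lt_two n) hf
  · exact XProtocol.completesWithin hf fun i c x => Snap.depth_snapProg _ v₀ i c x
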